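/- Let $n$ and $d$ be positive integers such that $d$ divides $n$, $1<d<n$ and $(n,d)\neq(4,2)$. Let $\mathrm S_n$ act on $\mathbb Q^n$ by permuting the standard basis, $\sigma(\varepsilon_i)=\varepsilon_{\sigma(i)}$, and let $$Q_n(d)=\sum_{i,j}\mathbb Z(\varepsilon_i-\varepsilon_j)+\mathbb Z\,d\,\varpi_1\subset\mathbb Q^n,\qquad \varpi_1=\varepsilon_1-\frac1n\sum_{i=1}^n\varepsilon_i .$$ For a finite group $\Gamma$, a $\Gamma$-lattice (a free abelian group of finite rank with an action of $\Gamma$ by automorphisms) is called a permutation lattice if it has a $\mathbb Z$-basis that is stable under $\Gamma$. A $\Gamma$-lattice $L$ is called quasi-permutation if there is an exact sequence of $\Gamma$-lattices $0\to L\to P\to Q\to 0$ with $P$ and $Q$ permutation lattices. Then: 1. the $\mathrm S_n$-lattice $Q_n(d)$ is not quasi-permutation; 2. for every algebraically closed field $k$ of characteristic $0$, the character lattice of the group $\mathrm{SL}_n/\mu_d$ over $k$ is not quasi-permutation. Here $\mu_d$ is the central subgroup $\{aI_n : a^d=1\}$, and the character lattice is the group $\widehat T=\mathrm{Hom}_{\mathrm{alg}}(T,\mathbf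 G_m)$ of characters of the maximal torus $T$ of $\mathrm{SL}_n/\mu_d$ which is the image of the diagonal torus of $\mathrm{SL}_n$, with its natural action of the Weyl group $W=N(T)/C(T)$. -/

import Mathlib

/-! ## Lattices with a group action

A `Γ`-lattice is a representation of `Γ` on a free abelian group of finite rank. -/

/-- A representation `ρ` of `Γ` over `ℤ` is a *permutation lattice* if its underlying abelian group
has a finite basis which is mapped into itself by every element of `Γ`. -/
def IsPermutationLattice {Γ : Type*} [Group Γ] {P : Type*} [AddCommGroup P]
    (ρ : Representation ℤ Γ P) : Prop :=
  ∃ (r : ℕ) (b : Module.Basis (Fin r) ℤ P), ∀ (g : Γ) (i : Fin r), ρ g (b i) ∈ Set.range b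

/-- A representation `ρ` of `Γ` over `ℤ` is a *quasi-permutation lattice* if there is an exact
sequence `0 ⟶ L ⟶ P ⟶ Q ⟶ 0` of `Γ`-equivariant maps with `P` and `Q` permutation lattices.
(Such an `L`, being embedded in `P`, is a lattice. As `P` and `Q` are free abelian of finite rank,
it is no restriction that they live in `Type`.) -/
def IsQuasiPermutationLattice {Γ : Type*} [Group Γ] {L : Type*} [AddCommGroup L]
    (ρ : Representation ℤ Γ L) : Prop :=
  ∃ (P Q : Type) (_ : AddCommGroup P) (_ : AddCommGroup Q)
    (ρP : Representation ℤ Γ P) (ρQ : Representation ℤ Γ Q)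
    (f : ρ.IntertwiningMap ρP) (g : ρP.IntertwiningMap ρQ),
    IsPermutationLattice ρP ∧ IsPermutationLattice ρQ ∧
      Function.Injective f ∧ Function.Exact f g ∧ Function.Surjective g

/-! ## The lattices `Q_n(d)` -/

/-- The action of the symmetric group on `ℚⁿ` by permuting coordinates. -/
def symRep (n : ℕ) : Representation ℤ (Equiv.Perm (Fin n)) (Fin n → ℚ) where
  toFun σ := LinearMap.funLeft ℤ ℚ (σ⁻¹ : Equiv.Perm (Fin n))
  map_one' := rfl
  map_mul' _ _ := rfl

/-- The vector `ε_i` of the standard basis of `ℚⁿ`. -/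
def stdVec (n : ℕ) (i : Fin n) : Fin n → ℚ := Pi.single i 1

/-- The symmetric group acts by `σ (ε_i) = ε_{σ i}`. -/
theorem symRep_stdVec (n : ℕ) (σ : Equiv.Perm (Fin n)) (i : Fin n) :
    symRep n σ (stdVec n i) = stdVec n (σ i) := by
  ext j
  change (Pi.single i 1 : Fin n → ℚ) (σ⁻¹ j) = (Pi.single (σ i) 1 : Fin n → ℚ) j
  simp only [Pi.single_apply, Equiv.Perm.inv_eq_iff_eq]

/-- The root lattice `ℤA_{n-1}`: the `ℤ`-span of the roots `ε_i - ε_j` in `ℚⁿ`. -/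
def rootLattice (n : ℕ) : Submodule ℤ (Fin n → ℚ) :=
  Submodule.span ℤ (Set.range fun p : Fin n × Fin n => stdVec n p.1 - stdVec n p.2)

/-- The vector `ε_i - (1/n) ∑_j ε_j`. -/
def fundWeight (n : ℕ) (i : Fin n) : Fin n → ℚ :=
  stdVec n i - (1 / (n : ℚ)) • ∑ j, stdVec n j

/-- `Q_n(d) = ℤA_{n-1} + ℤ d ϖ₁`, where `ϖ₁ = ε₁ - (1/n) ∑_j ε_j` is the first fundamental
weight. (The indices `1, …, n` are represented by `0, …, n - 1`.) -/
def latticeQ (n d : ℕ) [NeZero n] : Submodule ℤ (Fin n → ℚ) :=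
  rootLattice n ⊔ Submodule.span ℤ {(d : ℚ) • fundWeight n 0}

theorem stdVec_sub_mem_rootLattice (n : ℕ) (i j : Fin n) :
    stdVec n i - stdVec n j ∈ rootLattice n :=
  Submodule.subset_span ⟨(i, j), rfl⟩

theorem symRep_fundWeight (n : ℕ) (σ : Equiv.Perm (Fin n)) (i : Fin n) :
    symRep n σ (fundWeight n i) = fundWeight n (σ i) := by
  have h : ∑ j, stdVec n j = fun _ => (1 : ℚ) := by
    ext j
    simp [stdVec, Pi.single_apply]
  ext j
  have h2 := congrFun (symRep_stdVec n σ i) j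
  simp only [fundWeight, h]
  simpa [symRep] using h2

theorem symRep_mem_latticeQ (n d : ℕ) [NeZero n] (σ : Equiv.Perm (Fin n)) :
    latticeQ n d ≤ (latticeQ n d).comap (symRep n σ) := by
  refine sup_le ?_ ?_
  · refine Submodule.span_le.2 ?_
    rintro _ ⟨p, rfl⟩
    simp only [Submodule.comap_coe, Set.mem_preimage, map_sub, symRep_stdVec]
    exact Submodule.mem_sup_left (stdVec_sub_mem_rootLattice n _ _)
  · refine Submodule.span_le.2 (Set.singleton_subset_iff.2 ?_)
    have h : symRep n σ ((d : ℚ) • fundWeight n 0) =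
        d • (stdVec n (σ 0) - stdVec n 0) + (d : ℚ) • fundWeight n 0 := by
      have h1 : symRep n σ ((d : ℚ) • fundWeight n 0) = (d : ℚ) • fundWeight n (σ 0) := by
        rw [← symRep_fundWeight]; rfl
      rw [h1, ← Nat.cast_smul_eq_nsmul ℚ, ← smul_add]
      congr 1
      simp only [fundWeight]
      abel
    simp only [Submodule.comap_coe, Set.mem_preimage, h]
    exact add_mem (Submodule.mem_sup_left (nsmul_mem (stdVec_sub_mem_rootLattice n _ _) d))
      (Submodule.mem_sup_right (Submodule.mem_span_singleton_self _))

/-- The symmetric group action on `Q_n(d)`. -/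
def latticeQRep (n d : ℕ) [NeZero n] :
    Representation ℤ (Equiv.Perm (Fin n)) (latticeQ n d) where
  toFun σ := (symRep n σ).restrict (symRep_mem_latticeQ n d σ)
  map_one' := rfl
  map_mul' _ _ := rfl

/-! ## Weyl groups -/

/-- The Weyl group `N_G(T) / C_G(T)` of a subgroup `T` of `G`. -/
abbrev WeylGroup {G : Type*} [Group G] (T : Subgroup G) : Type _ :=
  Subgroup.normalizer (T : Set G) ⧸ T.normalizerMonoidHom.ker

/-- The kernel in the definition of the Weyl group is the centralizer. -/
theorem weylGroup_ker_eq_centralizer {G : Type*} [Group G] (T : Subgroup G) :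
    T.normalizerMonoidHom.ker =
      (Subgroup.centralizer (T : Set G)).subgroupOf (Subgroup.normalizer (T : Set G)) :=
  T.normalizerMonoidHom_ker

/-- The action of the Weyl group on `T` by conjugation, `t ↦ g t g⁻¹` for `g ∈ N_G(T)`. -/
def weylAct {G : Type*} [Group G] (T : Subgroup G) : WeylGroup T →* MulAut T :=
  QuotientGroup.kerLift T.normalizerMonoidHom

/-! ## The group `SL_n / μ_d` over a field, its diagonal torus and its character lattice -/

/-- The central subgroup `μ_d = {a · I_n | a^d = 1}` of `SL_n(k)`. -/
def muSubgroup (n d : ℕ) (k : Type*) [Field k] : Subgroup (Matrix.SpecialLinearGroup (Fin n) k) where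
  carrier := {g | ∃ a : kˣ, a ^ d = 1 ∧ (g : Matrix (Fin n) (Fin n) k) = Matrix.scalar (Fin n) (a : k)}
  one_mem' := ⟨1, by simp, by simp⟩
  mul_mem' := by
    rintro g h ⟨a, ha, hg⟩ ⟨b, hb, hh⟩
    exact ⟨a * b, by rw [mul_pow, ha, hb, one_mul],
      (Matrix.SpecialLinearGroup.coe_mul g h).trans (by rw [hg, hh, Units.val_mul, map_mul])⟩
  inv_mem' := by
    rintro g ⟨a, ha, hg⟩
    refine ⟨a⁻¹, by rw [inv_pow, ha, inv_one], ?_⟩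
    have h1 : (g⁻¹).1 * g.1 = 1 :=
      (Matrix.SpecialLinearGroup.coe_mul g⁻¹ g).symm.trans (congrArg Subtype.val (inv_mul_cancel g))
    have h2 : g.1 * Matrix.scalar (Fin n) ((a⁻¹ : kˣ) : k) = 1 := by
      rw [hg, ← map_mul, Units.mul_inv, map_one]
    calc (g⁻¹).1 = (g⁻¹).1 * (g.1 * Matrix.scalar (Fin n) ((a⁻¹ : kˣ) : k)) := by rw [h2, mul_one]
      _ = _ := by rw [← mul_assoc, h1, one_mul]

theorem muSubgroup_central {n d : ℕ} {k : Type*} [Field k]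
    {g : Matrix.SpecialLinearGroup (Fin n) k} (hg : g ∈ muSubgroup n d k)
    (h : Matrix.SpecialLinearGroup (Fin n) k) : h * g = g * h := by
  obtain ⟨a, -, ha⟩ := hg
  apply Subtype.ext
  refine (Matrix.SpecialLinearGroup.coe_mul h g).trans
    (Eq.trans ?_ (Matrix.SpecialLinearGroup.coe_mul g h).symm)
  rw [ha]
  exact ((Matrix.scalar_commute (a : k) (fun r => Commute.all _ r) h.1).eq).symm

instance muSubgroup_normal (n d : ℕ) (k : Type*) [Field k] : (muSubgroup n d k).Normal where
  conj_mem g hg h := by rwa [muSubgroup_central hg h, mul_inv_cancel_right]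

/-- The group `SL_n / μ_d` (its group of `k`-points, for `k` algebraically closed). -/
abbrev SLModMu (n d : ℕ) (k : Type*) [Field k] : Type _ :=
  Matrix.SpecialLinearGroup (Fin n) k ⧸ muSubgroup n d k

/-- The diagonal maximal torus of `SL_n`. -/
def diagTorusSL (n : ℕ) (k : Type*) [Field k] :
    Subgroup (Matrix.SpecialLinearGroup (Fin n) k) where
  carrier := {g | (g : Matrix (Fin n) (Fin n) k).IsDiag}
  one_mem' := Matrix.isDiag_one
  mul_mem' := by
    rintro g h hg hh
    change Matrix.IsDiag (g.1 * h.1)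
    rw [← (Matrix.isDiag_iff_diagonal_diag g.1).1 hg, ← (Matrix.isDiag_iff_diagonal_diag h.1).1 hh,
      Matrix.diagonal_mul_diagonal]
    exact Matrix.isDiag_diagonal _
  inv_mem' := by
    rintro g hg
    change Matrix.IsDiag (g.1.adjugate)
    rw [← (Matrix.isDiag_iff_diagonal_diag g.1).1 hg, Matrix.adjugate_diagonal]
    exact Matrix.isDiag_diagonal _

/-- The maximal torus `T` of `SL_n / μ_d` which is the image of the diagonal torus of `SL_n`. -/
def diagTorus (n d : ℕ) (k : Type*) [Field k] : Subgroup (SLModMu n d k) :=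
  (diagTorusSL n k).map (QuotientGroup.mk' (muSubgroup n d k))

/-- The projection from the diagonal torus of `SL_n` to that of `SL_n / μ_d`. -/
def diagTorusProj (n d : ℕ) (k : Type*) [Field k] : diagTorusSL n k →* diagTorus n d k :=
  (QuotientGroup.mk' (muSubgroup n d k)).subgroupMap (diagTorusSL n k)

/-- A function on the diagonal torus of `SL_n` is regular if it is a polynomial in the matrix
entries (the torus is a closed subvariety of the space of `n × n` matrices). -/
def IsRegularFun {n : ℕ} {k : Type*} [Field k] (φ : diagTorusSL n k → k) : Prop :=
  ∃ f : MvPolynomial (Fin n × Fin n) k, ∀ t : diagTorusSL n k,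
    φ t = MvPolynomial.eval (fun p => (t : Matrix.SpecialLinearGroup (Fin n) k).1 p.1 p.2) f

/-- The group of characters of the torus `T` of `SL_n / μ_d`: the homomorphisms `T → kˣ` of
algebraic groups. As `T` is the quotient of the diagonal torus of `SL_n` by the finite group `μ_d`,
the regular functions on `T` are those whose pullback to the diagonal torus of `SL_n` is regular. -/
def charGroup (n d : ℕ) (k : Type*) [Field k] : Subgroup (diagTorus n d k →* kˣ) where
  carrier := {χ | IsRegularFun fun t => (χ (diagTorusProj n d k t) : k)}
  one_mem' := ⟨1, fun t => by simp⟩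
  mul_mem' := by
    rintro χ ψ ⟨f, hf⟩ ⟨g, hg⟩
    exact ⟨f * g, fun t => by rw [map_mul, ← hf, ← hg]; rfl⟩
  inv_mem' := by
    rintro χ ⟨f, hf⟩
    refine ⟨MvPolynomial.bind₁
      (fun p => (Matrix.mvPolynomialX (Fin n) (Fin n) k).adjugate p.1 p.2) f, fun t => ?_⟩
    have h : ((χ (diagTorusProj n d k t⁻¹) : kˣ) : k) = _ := hf t⁻¹
    rw [map_inv, map_inv] at h
    refine h.trans ?_
    rw [← MvPolynomial.coe_aeval_eq_eval,
      ← MvPolynomial.coe_aeval_eq_eval, RingHom.coe_coe, RingHom.coe_coe,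
      MvPolynomial.aeval_bind₁]
    congr 2
    funext p
    have h2 := congrFun (congrFun (AlgHom.map_adjugate (MvPolynomial.aeval (R := k)
      (fun p => (t : Matrix.SpecialLinearGroup (Fin n) k).1 p.1 p.2))
      (Matrix.mvPolynomialX (Fin n) (Fin n) k)) p.1) p.2
    rw [Matrix.mvPolynomialX_mapMatrix_aeval] at h2
    exact h2.symm

theorem muSubgroup_le_diagTorusSL (n d : ℕ) (k : Type*) [Field k] :
    muSubgroup n d k ≤ diagTorusSL n k := by
  rintro g ⟨a, -, ha⟩
  change Matrix.IsDiag g.1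
  rw [ha]
  exact Matrix.isDiag_diagonal _

/-- The Weyl group action preserves the algebraic characters. -/
theorem comp_weylAct_mem_charGroup {n d : ℕ} {k : Type*} [Field k]
    (w : WeylGroup (diagTorus n d k)) {χ : diagTorus n d k →* kˣ} (hχ : χ ∈ charGroup n d k) :
    χ.comp (weylAct (diagTorus n d k) w).toMonoidHom ∈ charGroup n d k := by
  obtain ⟨⟨g, hg⟩, rfl⟩ := QuotientGroup.mk_surjective w
  obtain ⟨m, rfl⟩ := QuotientGroup.mk_surjective g
  obtain ⟨f, hf⟩ := hχ
  have hD : ∀ t : diagTorusSL n k, m * t.1 * m⁻¹ ∈ diagTorusSL n k := by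
    intro t
    obtain ⟨s, hs, hst⟩ := (Subgroup.mem_normalizer_iff.1 hg _).1 (diagTorusProj n d k t).2
    have h1 : s⁻¹ * (m * t.1 * m⁻¹) ∈ muSubgroup n d k := QuotientGroup.eq.1 hst
    have h2 := mul_mem hs (muSubgroup_le_diagTorusSL n d k h1)
    rwa [mul_inv_cancel_left] at h2
  let M : Matrix (Fin n) (Fin n) (MvPolynomial (Fin n × Fin n) k) :=
    m.1.map MvPolynomial.C * Matrix.mvPolynomialX (Fin n) (Fin n) k *
      (m⁻¹).1.map MvPolynomial.C
  refine ⟨MvPolynomial.bind₁ (fun p => M p.1 p.2) f, fun t => ?_⟩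
  have h : ((χ (diagTorusProj n d k ⟨_, hD t⟩) : kˣ) : k) = _ := hf ⟨_, hD t⟩
  refine Eq.trans ?_ (h.trans ?_)
  · rfl
  · rw [← MvPolynomial.coe_aeval_eq_eval,
      ← MvPolynomial.coe_aeval_eq_eval, RingHom.coe_coe, RingHom.coe_coe,
      MvPolynomial.aeval_bind₁]
    congr 2
    funext p
    change (m.1 * t.1.1 * (m⁻¹).1) p.1 p.2 = _
    simp [M, Matrix.mul_apply, map_sum]

/-- The character lattice of `SL_n / μ_d`: the group of characters of the torus `T`, written
additively, with the action `(w χ)(t) = χ (w⁻¹ t)` of the Weyl group `N(T) / C(T)`. -/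
def charLatticeRep (n d : ℕ) (k : Type*) [Field k] :
    Representation ℤ (WeylGroup (diagTorus n d k)) (Additive (charGroup n d k)) where
  toFun w := AddMonoidHom.toIntLinearMap <| MonoidHom.toAdditive
    { toFun := fun χ => ⟨χ.1.comp (weylAct (diagTorus n d k) w⁻¹).toMonoidHom,
        comp_weylAct_mem_charGroup w⁻¹ χ.2⟩
      map_one' := rfl
      map_mul' := fun _ _ => rfl }
  map_one' := by
    refine LinearMap.ext fun χ => Subtype.ext (MonoidHom.ext fun t => ?_)
    change χ.toMul.1 (weylAct (diagTorus n d k) 1⁻¹ t) = χ.toMul.1 t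
    rw [inv_one, map_one, MulAut.one_apply]
  map_mul' v w := by
    refine LinearMap.ext fun χ => Subtype.ext (MonoidHom.ext fun t => ?_)
    change χ.toMul.1 (weylAct (diagTorus n d k) (v * w)⁻¹ t) =
      χ.toMul.1 (weylAct (diagTorus n d k) w⁻¹ (weylAct (diagTorus n d k) v⁻¹ t))
    rw [mul_inv_rev, map_mul, MulAut.mul_apply]

/-! Both lattices are the same object: integral vectors on `Fin n` with coordinate sum divisible by
`d`, modulo constant vectors (`IsSumLattice`). A vector goes to its difference with its mean in
`latticeQ`, and to the monomial with those exponents in the character group; triviality on `μ_d` is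
exactly divisibility of the sum by `d`. Quasi-permutation lattices stay so under pullback along a
group homomorphism, so it is enough to find, for each `(n, d)`, a finite group `H` acting on `n`
points for which the pulled-back lattice `L` fails.

The main obstruction is the group of classes in `H¹(H, L ⊗ ℚ/ℤ) = H²(H, L)` that die on every cyclic
subgroup. It vanishes for a quasi-permutation lattice: by Shapiro's lemma a locally trivial class
dies in the permutation lattice, and invariants of `ℚ/ℤ`-valued functions on the second permutation
set lift by averaging (`PermResolution.coboundary`). For `L` as above this becomes a statement on
cocycles of rational functions modulo integral functions of suitable sum and constants
(`IsSumLattice.coboundary`). All nontrivial classes used come from one source: if a cyclic group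
acts on some orbits with lengths divisible by `q`, then a constant in `(1/q)ℤ` on these orbits is a
coboundary modulo integral functions (`exists_coboundary_of_label`).

Let `p` be a prime dividing `n / d`. If `n ≠ p d`, or if `n = p d` with `p ∤ d` and `d > 2`, the
group `(ℤ/p)²` acts on blocks of length `p` through three different quotients and carries such a
class. If `n = p d` with `p ∣ d`, blocks of length `p²` are used, with affine maps of `ℤ/p²` for odd
`p` and with `(ℤ/4)²` for `p = 2`; only the latter needs two blocks, whence the exception `(4, 2)`.

In the remaining case `n = 2p`, `d = 2`, `p` odd, a counting argument replaces cohomological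
obstruction. For `H = (ℤ/p)²` acting on two blocks, `H¹(H, L) = 0`, so ranks of invariants and
orders of invariants modulo norms are compatible with a resolution. Those numbers satisfy a
congruence modulo `(p - 1)²` for permutation lattices, and `L` violates it. -/

/-! ## Permutation representations and resolutions by them -/

/-- The representation of `H` on integral functions on an `H`-set. -/
def permRep (H X : Type*) [Group H] [MulAction H X] : Representation ℤ H (X → ℤ) where
  toFun h := LinearMap.funLeft ℤ ℤ (fun x => h⁻¹ • x)
  map_one' := by ext; simp [LinearMap.funLeft_apply]
  map_mul' g h := by ext; simp [LinearMap.funLeft_apply, mul_smul]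

@[simp]
theorem permRep_apply {H X : Type*} [Group H] [MulAction H X] (h : H) (p : X → ℤ) (x : X) :
    permRep H X h p x = p (h⁻¹ • x) := rfl

/-- A short exact sequence `0 ⟶ L ⟶ ℤ^X ⟶ ℤ^Y ⟶ 0` of `H`-lattices for `H`-sets `X` and `Y`. -/
structure PermResolution {H L : Type*} [Group H] [AddCommGroup L] (ρ : Representation ℤ H L)
    (X Y : Type*) [MulAction H X] [MulAction H Y] where
  f : L →ₗ[ℤ] X → ℤ
  g : (X → ℤ) →ₗ[ℤ] Y → ℤ
  f_rho : ∀ h l, f (ρ h l) = permRep H X h (f l)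
  g_rho : ∀ h p, g (permRep H X h p) = permRep H Y h (g p)
  f_inj : Function.Injective f
  exact : Function.Exact f g
  g_surj : Function.Surjective g

theorem IsPermutationLattice.exists_equiv {H P : Type*} [Group H] [AddCommGroup P]
    {ρ : Representation ℤ H P} (hP : IsPermutationLattice ρ) :
    ∃ (r : ℕ) (_ : MulAction H (Fin r)) (e : P ≃ₗ[ℤ] (Fin r → ℤ)),
      ∀ h p, e (ρ h p) = permRep H (Fin r) h (e p) := by
  obtain ⟨r, b, hb⟩ := hP
  choose s hs using hb
  let act : MulAction H (Fin r) :=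
    { smul := s
      one_smul := fun i => b.injective (by
        change b (s 1 i) = b i
        rw [hs, map_one]; rfl)
      mul_smul := fun g h i => b.injective (by
        change b (s (g * h) i) = b (s g (s h i))
        rw [hs, hs, hs, map_mul]; rfl) }
  have hsm : ∀ h i, b (h • i) = ρ h (b i) := hs
  refine ⟨r, act, b.equivFun, fun h p => ?_⟩
  have key : b.equivFun.toLinearMap ∘ₗ ρ h = permRep H (Fin r) h ∘ₗ b.equivFun.toLinearMap := by
    refine b.ext fun i => ?_
    ext j
    simp only [LinearMap.comp_apply, LinearEquiv.coe_coe, permRep_apply]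
    rw [← hsm, b.equivFun_self, b.equivFun_self]
    congr 1
    exact propext (by rw [eq_inv_smul_iff])
  exact LinearMap.congr_fun key p

/-- Stable bases and exactness survive pullback along any homomorphism, so a single group mapping to
`Γ` can refute the property for `Γ`. -/
theorem IsQuasiPermutationLattice.comp {Γ H L : Type*} [Group Γ] [Group H] [AddCommGroup L]
    {ρ : Representation ℤ Γ L} (hρ : IsQuasiPermutationLattice ρ) (φ : H →* Γ) :
    IsQuasiPermutationLattice (ρ.comp φ : Representation ℤ H L) := by
  obtain ⟨P, Q, _, _, ρP, ρQ, f, g, ⟨r, b, hb⟩, ⟨s, c, hc⟩, hf, hfg, hg⟩ := hρ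
  exact ⟨P, Q, _, _, ρP.comp φ, ρQ.comp φ,
    ⟨f.toLinearMap, fun h => f.isIntertwining' (φ h)⟩,
    ⟨g.toLinearMap, fun h => g.isIntertwining' (φ h)⟩,
    ⟨r, b, fun h i => hb (φ h) i⟩, ⟨s, c, fun h i => hc (φ h) i⟩, hf, hfg, hg⟩

theorem IsQuasiPermutationLattice.exists_resolution {H L : Type*} [Group H] [AddCommGroup L]
    {ρ : Representation ℤ H L} (hρ : IsQuasiPermutationLattice ρ) :
    ∃ (r s : ℕ) (_ : MulAction H (Fin r)) (_ : MulAction H (Fin s)),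
      Nonempty (PermResolution ρ (Fin r) (Fin s)) := by
  obtain ⟨P, Q, _, _, ρP, ρQ, f, g, hP, hQ, hf, hfg, hg⟩ := hρ
  obtain ⟨r, actP, eP, heP⟩ := hP.exists_equiv
  obtain ⟨s, actQ, eQ, heQ⟩ := hQ.exists_equiv
  refine ⟨r, s, actP, actQ, ⟨⟨eP.toLinearMap ∘ₗ f.toLinearMap,
    eQ.toLinearMap ∘ₗ g.toLinearMap ∘ₗ eP.symm.toLinearMap, fun h l => ?_, fun h p => ?_,
    eP.injective.comp hf, fun p => ?_, eQ.surjective.comp (hg.comp eP.symm.surjective)⟩⟩⟩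
  · have := LinearMap.congr_fun (f.isIntertwining' h) l
    simp only [LinearMap.comp_apply, LinearEquiv.coe_coe] at this ⊢
    rw [this, heP]
  · have := LinearMap.congr_fun (g.isIntertwining' h) (eP.symm p)
    simp only [LinearMap.comp_apply, LinearEquiv.coe_coe] at this ⊢
    rw [← heQ, ← this]
    congr 2
    rw [LinearEquiv.symm_apply_eq, heP, LinearEquiv.apply_symm_apply]
  · simp only [LinearMap.comp_apply, LinearEquiv.coe_coe, LinearEquiv.map_eq_zero_iff,
      Set.mem_range]
    refine (hfg (eP.symm p)).trans ⟨fun ⟨l, hl⟩ => ⟨l, ?_⟩, fun ⟨l, hl⟩ => ⟨l, ?_⟩⟩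
    · change eP (f l) = p
      rw [hl, LinearEquiv.apply_symm_apply]
    · rw [← hl, LinearEquiv.symm_apply_apply]; rfl

/-! ## Locally trivial cocycles with divisible coefficients -/

section Cocycle

variable {H L X Y : Type*} [Group H] [AddCommGroup L] [MulAction H X] [MulAction H Y]

/-- In a permutation module, a cocycle modulo `m` whose values vanish at the fixed points modulo `m`
is a coboundary modulo `m`. -/
theorem permRep_coboundary (m : ℤ) (c : H → X → ℤ)
    (hc : ∀ g h x, m ∣ c (g * h) x - c g x - c h (g⁻¹ • x))
    (hloc : ∀ h x, h • x = x → m ∣ c h x) :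
    ∃ w : X → ℤ, ∀ h x, m ∣ c h x - (w (h⁻¹ • x) - w x) := by
  have hrep : ∀ x : X, ∃ h : H, h⁻¹ • (Quotient.out (s := MulAction.orbitRel H X) ⟦x⟧) = x := by
    intro x
    have h1 : (MulAction.orbitRel H X).r x (Quotient.out (s := MulAction.orbitRel H X) ⟦x⟧) :=
      Setoid.symm' _ (Quotient.mk_out (s := MulAction.orbitRel H X) x)
    obtain ⟨h, hh⟩ := h1
    exact ⟨h⁻¹, by rw [inv_inv]; exact hh⟩
  choose t ht using hrep
  let x₀ : X → X := fun x => Quotient.out (s := MulAction.orbitRel H X) ⟦x⟧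
  have ht' : ∀ x, (t x)⁻¹ • x₀ x = x := ht
  have hx₀ : ∀ (h : H) x, x₀ (h • x) = x₀ x := by
    intro h x
    have : (Quotient.mk (MulAction.orbitRel H X) (h • x)) = Quotient.mk _ x :=
      Quotient.sound (s := MulAction.orbitRel H X) ⟨h, rfl⟩
    simp only [x₀, this]
  -- Shapiro's lemma made explicit: `t x` links `x` to its orbit representative `x₀ x`. The defect
  -- of the coboundary relation is the value of `c` at `x₀ x` on an element fixing `x₀ x`, which
  -- vanishes modulo `m` by `hloc`.
  refine ⟨fun x => c (t x) (x₀ x), fun h x => ?_⟩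
  have hu : (t (h⁻¹ • x) * (t x * h)⁻¹) • x₀ x = x₀ x := by
    have h1 := ht' (h⁻¹ • x)
    rw [hx₀] at h1
    rw [mul_inv_rev, mul_smul, mul_smul, ht' x]
    exact (inv_smul_eq_iff.1 h1).symm
  have e1 := hc (t (h⁻¹ • x) * (t x * h)⁻¹) (t x * h) (x₀ x)
  have e2 := hc (t x) h (x₀ x)
  have e3 := hloc _ _ hu
  rw [inv_mul_cancel_right, inv_smul_eq_iff.2 hu.symm] at e1
  rw [ht' x] at e2
  have := dvd_add (dvd_add e1 e2) e3
  simp only [hx₀]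
  rw [← dvd_neg]
  convert this using 1
  ring

/-- For a quasi-permutation lattice, the group `Ш¹` with coefficients in `L ⊗ ℚ/ℤ` vanishes: a
cocycle `c / m` which is a coboundary on every cyclic subgroup is a coboundary. -/
theorem PermResolution.coboundary [Finite H] {ρ : Representation ℤ H L} (R : PermResolution ρ X Y)
    {m : ℤ} (hm : m ≠ 0) (c : H → L)
    (hc : ∀ g h, ∃ l, c (g * h) - c g - ρ g (c h) = m • l)
    (hloc : ∀ h, ∃ k : ℤ, k ≠ 0 ∧ ∃ v l, k • c h - m • (ρ h v - v) = (m * k) • l) :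
    ∃ (N : ℤ) (v : L), N ≠ 0 ∧ ∀ h, ∃ l, N • c h - (ρ h v - v) = (m * N) • l := by
  have := Fintype.ofFinite H
  obtain ⟨w, hw⟩ := permRep_coboundary m (fun h => R.f (c h))
    (by
      intro g h x
      obtain ⟨l, hl⟩ := hc g h
      have h1 := congrFun (congrArg R.f hl) x
      simp only [map_sub, map_smul, R.f_rho, Pi.sub_apply, permRep_apply, Pi.smul_apply,
        smul_eq_mul] at h1
      exact ⟨_, h1⟩)
    (by
      intro h x hx
      obtain ⟨k, hk, v, l, hl⟩ := hloc h
      -- At a fixed point the coboundary term vanishes, so local triviality forces `m` to divide the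
      -- cocycle there.
      have hx' : h⁻¹ • x = x := inv_smul_eq_iff.2 hx.symm
      have h1 := congrFun (congrArg R.f hl) x
      simp only [map_sub, map_smul, R.f_rho, Pi.sub_apply, permRep_apply, Pi.smul_apply,
        smul_eq_mul, hx', sub_self, mul_zero, sub_zero] at h1
      refine ⟨R.f l x, mul_left_cancel₀ hk ?_⟩
      rw [h1]; ring)
  choose w' hw' using hw
  have hw2 : ∀ h, R.f (c h) - (permRep H X h w - w) = m • w' h := by
    intro h
    ext x
    exact hw' h x
  have hgf : ∀ l, R.g (R.f l) = 0 := R.exact.apply_apply_eq_zero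
  -- The image of `w` in `ℤ^Y` is invariant modulo `m`, hence congruent to a function constant on
  -- orbits. The latter is lifted to `ℤ^X` and averaged to an invariant `p`, at the cost of the
  -- factor `N = |H|`. Correcting `N • w` by `p` and by a multiple of `m * N` brings it into the
  -- image of `L`.
  have hinv : ∀ (h : H) (y : Y), m ∣ R.g w (h⁻¹ • y) - R.g w y := by
    intro h y
    have h1 := congrFun (congrArg R.g (hw2 h)) y
    simp only [map_sub, hgf, R.g_rho, map_smul, Pi.sub_apply, Pi.zero_apply, permRep_apply,
      Pi.smul_apply, smul_eq_mul] at h1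
    exact ⟨-R.g (w' h) y, by linarith⟩
  let y₀ : Y → Y := fun y => Quotient.out (s := MulAction.orbitRel H Y) ⟦y⟧
  have hy₀ : ∀ (h : H) y, y₀ (h • y) = y₀ y := by
    intro h y
    have : (Quotient.mk (MulAction.orbitRel H Y) (h • y)) = Quotient.mk _ y :=
      Quotient.sound (s := MulAction.orbitRel H Y) ⟨h, rfl⟩
    simp only [y₀, this]
  have hq : ∀ y, m ∣ R.g w y - R.g w (y₀ y) := by
    intro y
    have h1 : (MulAction.orbitRel H Y).r y (y₀ y) :=
      Setoid.symm' _ (Quotient.mk_out (s := MulAction.orbitRel H Y) y)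
    obtain ⟨h, hh⟩ := h1
    have h2 := hinv h⁻¹ (y₀ y)
    rw [inv_inv] at h2
    have hh' : h • y₀ y = y := hh
    rwa [hh'] at h2
  choose q' hq' using hq
  obtain ⟨p₀, hp₀⟩ := R.g_surj fun y => R.g w (y₀ y)
  let p : X → ℤ := ∑ h : H, permRep H X h p₀
  have hp : R.g p = (Fintype.card H : ℤ) • fun y => R.g w (y₀ y) := by
    ext y
    simp only [p, map_sum, R.g_rho, hp₀, Finset.sum_apply, permRep_apply, hy₀, Finset.sum_const,
      Finset.card_univ, Pi.smul_apply, smul_eq_mul, nsmul_eq_mul]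
  have hpinv : ∀ h, permRep H X h p = p := by
    intro h
    simp only [p, map_sum, ← Module.End.mul_apply, ← map_mul]
    exact Fintype.sum_equiv (Equiv.mulLeft h) _ _ fun _ => rfl
  obtain ⟨p₁, hp₁⟩ := R.g_surj q'
  set N : ℤ := (Fintype.card H : ℤ) with hN
  obtain ⟨v, hv⟩ := (R.exact (N • w - p - (m * N) • p₁)).1 (by
    ext y
    simp only [map_sub, map_smul, hp, hp₁, Pi.sub_apply, Pi.smul_apply, smul_eq_mul, Pi.zero_apply]
    have := hq' y
    linear_combination N * this)
  refine ⟨N, v, by simp [hN], fun h => ?_⟩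
  have h3 : R.f (N • c h - (ρ h v - v)) = (m * N) • (w' h + (permRep H X h p₁ - p₁)) := by
    have h4 := hw2 h
    simp only [map_sub, map_smul, R.f_rho, hv, hpinv]
    have h5 : R.f (c h) = m • w' h + (permRep H X h w - w) := by rw [← h4]; abel
    rw [h5]
    module
  obtain ⟨l, hl⟩ := (R.exact (w' h + (permRep H X h p₁ - p₁))).1 (by
    have h6 := congrArg R.g h3
    rw [hgf, map_smul] at h6
    have : m * N ≠ 0 := mul_ne_zero hm (by simp [hN])
    exact (smul_eq_zero.1 h6.symm).resolve_left this)
  exact ⟨l, R.f_inj (by rw [h3, map_smul, hl])⟩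

end Cocycle

/-! ## Lattices of integral functions with divisible sum, modulo constants -/

/-- The integral functions on `X` the sum of whose values is divisible by `d`. -/
def divSum (X : Type*) [Fintype X] (d : ℕ) : AddSubgroup (X → ℤ) where
  carrier := {a | (d : ℤ) ∣ ∑ x, a x}
  zero_mem' := by simp
  add_mem' := by
    intro a b ha hb
    simpa only [Set.mem_ofPred_eq, Pi.add_apply, Finset.sum_add_distrib] using dvd_add ha hb
  neg_mem' := by
    intro a ha
    simpa only [Set.mem_ofPred_eq, Pi.neg_apply, Finset.sum_neg_distrib, dvd_neg] using ha

theorem mem_divSum {X : Type*} [Fintype X] {d : ℕ} {a : X → ℤ} :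
    a ∈ divSum X d ↔ (d : ℤ) ∣ ∑ x, a x := Iff.rfl

theorem sum_comp_smul {H X M : Type*} [Group H] [MulAction H X] [Fintype X] [AddCommMonoid M] (h : H)
    (a : X → M) : ∑ x, a (h • x) = ∑ x, a x :=
  Equiv.sum_comp (MulAction.toPerm h) a

theorem permRep_mem_divSum {H X : Type*} [Group H] [MulAction H X] [Fintype X] {d : ℕ} (h : H)
    {a : X → ℤ} (ha : a ∈ divSum X d) : permRep H X h a ∈ divSum X d := by
  rw [mem_divSum] at ha ⊢
  simp only [permRep_apply]
  rwa [sum_comp_smul]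

/-- A lattice with an action of `H` which is equivariantly isomorphic to the quotient of `divSum X d`
by the constant functions, for an `H`-set `X`. -/
def IsSumLattice {H L : Type*} [Group H] [AddCommGroup L] (ρ : Representation ℤ H L)
    (X : Type*) [MulAction H X] [Fintype X] (d : ℕ) : Prop :=
  ∃ π : divSum X d →+ L, Function.Surjective π ∧
    (∀ a, π a = 0 ↔ ∃ m : ℤ, ∀ x, a.1 x = m) ∧
    ∀ h (a : divSum X d), π ⟨permRep H X h a.1, permRep_mem_divSum h a.2⟩ = ρ h (π a)

theorem IsSumLattice.congr {G H L X Y : Type*} [Group G] [Group H] [AddCommGroup L]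
    [MulAction G X] [MulAction H Y] [Fintype X] [Fintype Y] {d : ℕ} {ρ : Representation ℤ G L}
    (hρ : IsSumLattice ρ X d) (φ : H →* G) (e : Y ≃ X) (he : ∀ h y, e (h • y) = φ h • e y) :
    IsSumLattice (ρ.comp φ : Representation ℤ H L) Y d := by
  obtain ⟨π, hs, hk, heq⟩ := hρ
  have hmem : ∀ a : divSum Y d, (fun x => a.1 (e.symm x)) ∈ divSum X d := fun a => by
    rw [mem_divSum, Equiv.sum_comp e.symm a.1]; exact a.2
  have hmem' : ∀ a : divSum X d, (fun x => a.1 (e x)) ∈ divSum Y d := fun a => by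
    rw [mem_divSum, Equiv.sum_comp e a.1]; exact a.2
  refine ⟨{ toFun := fun a => π ⟨_, hmem a⟩
            map_zero' := map_zero π
            map_add' := fun a b => map_add π ⟨_, hmem a⟩ ⟨_, hmem b⟩ }, ?_, ?_, ?_⟩
  · intro l
    obtain ⟨a, rfl⟩ := hs l
    refine ⟨⟨_, hmem' a⟩, ?_⟩
    simp
  · intro a
    refine (hk _).trans ⟨fun ⟨m, hm⟩ => ⟨m, fun y => ?_⟩, fun ⟨m, hm⟩ => ⟨m, fun x => hm _⟩⟩
    simpa using hm (e y)
  · intro h a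
    refine Eq.trans ?_ (heq (φ h) ⟨_, hmem a⟩)
    change π _ = π _
    congr 2
    ext x
    simp only [permRep_apply]
    refine congrArg a.1 ?_
    rw [Equiv.eq_symm_apply, he, Equiv.apply_symm_apply, map_inv]

theorem exists_common_denom {ι : Type*} [Finite ι] (d : ℕ) (hd : d ≠ 0) (u : ι → ℚ) :
    ∃ m : ℤ, m ≠ 0 ∧ ∃ a : ι → ℤ, (∀ i, (d : ℤ) ∣ a i) ∧ ∀ i, (a i : ℚ) = m * u i := by
  have := Fintype.ofFinite ι
  obtain ⟨b, hb⟩ := IsLocalization.exist_integer_multiples_of_finite (nonZeroDivisors ℤ) u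
  choose a ha using hb
  -- The extra factor `d` puts the cleared function into `divSum`.
  refine ⟨d * b, mul_ne_zero (by exact_mod_cast hd) (nonZeroDivisors.ne_zero b.2),
    fun i => d * a i, fun i => dvd_mul_right _ _, fun i => ?_⟩
  have := ha i
  simp only [zsmul_eq_mul, algebraMap_int_eq, eq_intCast] at this
  push_cast
  rw [this, mul_assoc]

/-- The rational functions which are, up to a constant, in `divSum X d`. -/
def divSumQ (X : Type*) [Fintype X] (d : ℕ) : AddSubgroup (X → ℚ) where
  carrier := {v | ∃ a ∈ divSum X d, ∃ r : ℚ, ∀ x, v x = a x + r}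
  zero_mem' := ⟨0, zero_mem _, 0, by simp⟩
  add_mem' := by
    rintro v w ⟨a, ha, r, hv⟩ ⟨b, hb, s, hw⟩
    exact ⟨a + b, add_mem ha hb, r + s, fun x => by
      simp only [Pi.add_apply, hv, hw]; push_cast; ring⟩
  neg_mem' := by
    rintro v ⟨a, ha, r, hv⟩
    exact ⟨-a, neg_mem ha, -r, fun x => by
      simp only [Pi.neg_apply, hv]; push_cast; ring⟩

/-- If `divSum X d` modulo constants is a quasi-permutation lattice, then every cocycle with values
in `ℚ^X` modulo `divSumQ X d` which is locally a coboundary is a coboundary. -/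
theorem IsSumLattice.coboundary {H L X : Type*} [Group H] [Finite H] [AddCommGroup L]
    [MulAction H X] [Fintype X] [Nonempty X] {d : ℕ} {ρ : Representation ℤ H L}
    (hL : IsSumLattice ρ X d) (hq : IsQuasiPermutationLattice ρ) (hd : d ≠ 0)
    (c : H → X → ℚ)
    (hc : ∀ g h, (fun x => c (g * h) x - c g x - c h (g⁻¹ • x)) ∈ divSumQ X d)
    (hloc : ∀ h, ∃ v : X → ℚ, (fun x => c h x - (v (h⁻¹ • x) - v x)) ∈ divSumQ X d) :
    ∃ v : X → ℚ, ∀ h, (fun x => c h x - (v (h⁻¹ • x) - v x)) ∈ divSumQ X d := by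
  obtain ⟨r, s, _, _, ⟨R⟩⟩ := hq.exists_resolution
  obtain ⟨π, hs, hk, heq⟩ := hL
  let x₀ : X := Classical.arbitrary X
  have hker : ∀ (b : divSum X d) (r : ℚ), (∀ x, (b.1 x : ℚ) = r) → π b = 0 := by
    intro b r hb
    refine (hk b).2 ⟨b.1 x₀, fun x => ?_⟩
    have := (hb x).trans (hb x₀).symm
    exact_mod_cast this
  obtain ⟨m, hm, a, had, ha⟩ := exists_common_denom d hd (fun i : H × X => c i.1 i.2)
  let c' : H → divSum X d := fun h => ⟨fun x => a (h, x), Finset.dvd_sum fun x _ => had _⟩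
  have hc' : ∀ h x, ((c' h).1 x : ℚ) = m * c h x := fun h x => ha (h, x)
  obtain ⟨N, w, hN, hw⟩ := R.coboundary hm (fun h => π (c' h))
    (by
      intro g h
      obtain ⟨b, hb, t, ht⟩ := hc g h
      refine ⟨π ⟨b, hb⟩, ?_⟩
      rw [← heq, ← map_sub, ← map_sub, ← map_zsmul, ← sub_eq_zero, ← map_sub]
      refine hker _ (m * t) fun x => ?_
      have h1 := ht x
      simp only [AddSubgroup.coe_sub, AddSubgroup.coe_zsmul, Pi.sub_apply, permRep_apply,
        Pi.smul_apply, smul_eq_mul]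
      push_cast
      rw [hc', hc', hc']
      linear_combination (m : ℚ) * h1)
    (by
      intro h
      obtain ⟨v, b, hb, t, ht⟩ := hloc h
      obtain ⟨k, hk0, u, hud, hu⟩ := exists_common_denom d hd v
      refine ⟨k, hk0, π ⟨u, Finset.dvd_sum fun x _ => hud _⟩, π ⟨b, hb⟩, ?_⟩
      rw [← heq, ← map_sub, ← map_zsmul, ← map_zsmul, ← map_sub, ← map_zsmul, ← sub_eq_zero,
        ← map_sub]
      refine hker _ (m * k * t) fun x => ?_
      have h1 := ht x
      simp only [AddSubgroup.coe_sub, AddSubgroup.coe_zsmul, Pi.sub_apply, permRep_apply,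
        Pi.smul_apply, smul_eq_mul]
      push_cast
      rw [hc', hu, hu]
      linear_combination (m * k : ℚ) * h1)
  obtain ⟨b, rfl⟩ := hs w
  refine ⟨fun x => b.1 x / (m * N), fun h => ?_⟩
  obtain ⟨l, hl⟩ := hw h
  obtain ⟨e, rfl⟩ := hs l
  rw [← heq, ← map_sub, ← map_zsmul, ← map_zsmul, ← map_sub, ← sub_eq_zero, ← map_sub] at hl
  obtain ⟨z, hz⟩ := (hk _).1 hl
  refine ⟨e.1, e.2, z / (m * N), fun x => ?_⟩
  have h1 : ((N * (c' h).1 x - (b.1 (h⁻¹ • x) - b.1 x) - m * N * e.1 x : ℤ) : ℚ) = z := by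
    exact_mod_cast hz x
  have hmQ : (m : ℚ) ≠ 0 := by exact_mod_cast hm
  have hNQ : (N : ℚ) ≠ 0 := by exact_mod_cast hN
  push_cast at h1
  rw [hc'] at h1
  field_simp
  linear_combination h1

/-- If a function `v` satisfies `h v - v ∈ ℤ^X + ℚ` for all `h`, the constants modulo `ℤ` form a
homomorphism. -/
theorem const_add_mem_int {H X : Type*} [Group H] [MulAction H X] [Nonempty X] (v : X → ℚ)
    (c : H → X → ℤ) (r : H → ℚ) (hv : ∀ h x, v (h⁻¹ • x) - v x = c h x + r h) (g h : H) :
    ∃ z : ℤ, r (g * h) = r g + r h + z := by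
  let x : X := Classical.arbitrary X
  have h1 := hv (g * h) x
  have h2 := hv g x
  have h3 := hv h (g⁻¹ • x)
  rw [mul_inv_rev, mul_smul] at h1
  refine ⟨c g x + c h (g⁻¹ • x) - c (g * h) x, ?_⟩
  push_cast
  linear_combination h2 + h3 - h1

/-! ## Two criteria for not being quasi-permutation -/

theorem ZMod.exists_val_eq_add {q : ℕ} [NeZero q] {z w : ZMod q} {a : ℤ} (h : w = z + a) :
    ∃ e : ℤ, (w.val : ℤ) = z.val + a + q * e := by
  have h1 : ((z.val + a : ℤ) : ZMod q) = ((w.val : ℤ) : ZMod q) := by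
    push_cast
    rw [ZMod.natCast_zmod_val, ZMod.natCast_zmod_val, h]
  obtain ⟨e, he⟩ := (ZMod.intCast_eq_intCast_iff_dvd_sub _ _ _).1 h1
  exact ⟨e, by linarith⟩

/-- A labelling by `ℤ/q` of a part of `X` on which `h` acts by `x ↦ x + 1` makes the constant `t / q`
on this part a coboundary modulo `ℤ`. -/
theorem exists_coboundary_of_label {H X : Type*} [Group H] [MulAction H X] [Fintype X] {q : ℕ}
    [NeZero q] (h : H) (F : X → ZMod q) (ind : X → ℤ) (hind : ∀ x, ind (h⁻¹ • x) = ind x)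
    (hF : ∀ x, ind x ≠ 0 → F (h⁻¹ • x) = F x - 1) (t : ℤ) :
    ∃ (v : X → ℚ) (e : X → ℤ), (∀ x, v (h⁻¹ • x) - v x = ind x * (t / q) + e x) ∧
      q * ∑ x, e x = -(t * ∑ x, ind x) := by
  have hq : (q : ℚ) ≠ 0 := by exact_mod_cast NeZero.ne q
  have h1 : ∀ x, ∃ e : ℤ, ind x * ((F (h⁻¹ • x)).val : ℤ) = ind x * ((F x).val - 1 + q * e) := by
    intro x
    by_cases hx : ind x = 0
    · exact ⟨0, by simp [hx]⟩
    · obtain ⟨e, he⟩ := ZMod.exists_val_eq_add (a := -1) (z := F x) (w := F (h⁻¹ • x))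
        (by rw [hF x hx]; push_cast; ring)
      exact ⟨e, by rw [he]; ring⟩
  choose e he using h1
  -- Labels are lifted to `0, …, q - 1`; the integers `e` record the wrap-around. Their sum is then
  -- forced, since the sum of `v (h⁻¹ • x) - v x` over `X` is zero.
  let v : X → ℚ := fun x => -(t * ind x * (F x).val / q)
  have hv : ∀ x, v (h⁻¹ • x) - v x = ind x * (t / q) + (-(t * ind x * e x) : ℤ) := by
    intro x
    have h2 : (ind x : ℚ) * (F (h⁻¹ • x)).val = ind x * ((F x).val - 1 + q * e x) := by
      exact_mod_cast he x
    simp only [v, hind]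
    push_cast
    field_simp
    linear_combination -(t : ℚ) * h2
  refine ⟨v, fun x => -(t * ind x * e x), hv, ?_⟩
  have h3 : ∑ x, (v (h⁻¹ • x) - v x) = 0 := by
    rw [Finset.sum_sub_distrib, sum_comp_smul, sub_self]
  simp only [hv, Finset.sum_add_distrib, ← Finset.sum_mul] at h3
  field_simp at h3
  have h4 : (t * ∑ x, ind x + q * ∑ x, -(t * ind x * e x) : ℤ) = 0 := by
    have : ((t * ∑ x, ind x + q * ∑ x, -(t * ind x * e x) : ℤ) : ℚ) = 0 := by
      push_cast at h3 ⊢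
      linear_combination h3
    exact_mod_cast this
  linarith

/-- The homomorphism `a` modulo `p` gives a cocycle of integral functions with sum `a h * (d / p)`,
seen modulo functions with sum divisible by `d`. The labelling by `ℤ/p²` makes it locally trivial. A
global trivialization would produce a homomorphism `r : H → ℚ/ℤ` that vanishes on elements with a
fixed point; the relation `u ^ p * w₁ = w₂` then makes `p * r u` integral, and summing over `X`
gives `p ∣ a u`. -/
theorem not_isQuasiPermutationLattice_of_hom {H L X : Type*} [Group H] [Finite H] [AddCommGroup L]
    [MulAction H X] [Fintype X] {ρ : Representation ℤ H L} {p d : ℕ} (hp : p.Prime)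
    (hd : d ≠ 0) (hpd : p ∣ d) (hX : Fintype.card X = p * d) (hL : IsSumLattice ρ X d)
    (a : H → ℤ) (ha : ∀ g h, (p : ℤ) ∣ a (g * h) - a g - a h)
    (hloc : ∀ h, ¬ (p : ℤ) ∣ a h → ∃ F : X → ZMod (p ^ 2), ∀ x, F (h • x) = F x + 1)
    (u w₁ w₂ : H) (hu : ¬ (p : ℤ) ∣ a u) (huw : u ^ p * w₁ = w₂)
    (hw₁ : ∃ x : X, w₁ • x = x) (hw₂ : ∃ x : X, w₂ • x = x) :
    ¬ IsQuasiPermutationLattice ρ := by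
  classical
  intro hq
  obtain ⟨d', rfl⟩ := hpd
  have hp0 : p ≠ 0 := hp.ne_zero
  have hd'0 : d' ≠ 0 := right_ne_zero_of_mul hd
  have : NeZero (p ^ 2) := ⟨pow_ne_zero _ hp0⟩
  have hXne : Nonempty X := Fintype.card_pos_iff.1 (by
    rw [hX]; exact Nat.pos_of_ne_zero (mul_ne_zero hp0 hd))
  let x₀ : X := Classical.arbitrary X
  -- Only the sum matters modulo `divSum`, so the mass may sit at one arbitrary point.
  let b : H → X → ℤ := fun h => Pi.single x₀ (a h * d')
  have hb : ∀ h, ∑ x, b h x = a h * d' := fun h => by simp [b]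
  obtain ⟨v, hv⟩ := hL.coboundary hq hd (fun h x => b h x)
    (by
      intro g h
      refine ⟨fun x => b (g * h) x - b g x - b h (g⁻¹ • x), ?_, 0, fun x => by push_cast; ring⟩
      rw [mem_divSum, Finset.sum_sub_distrib, Finset.sum_sub_distrib, sum_comp_smul, hb, hb, hb,
        ← sub_mul, ← sub_mul, Nat.cast_mul]
      exact mul_dvd_mul_right (ha g h) _)
    (by
      intro h
      by_cases hh : (p : ℤ) ∣ a h
      · refine ⟨0, b h, ?_, 0, fun x => by simp⟩
        rw [mem_divSum, hb, Nat.cast_mul]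
        exact mul_dvd_mul_right hh _
      · obtain ⟨F, hF⟩ := hloc h hh
        -- The integral part `e` of the coboundary with constant `-a h / p²` has sum `a h * d'`,
        -- because `|X| = p² d'`; this is the sum of `b h`.
        obtain ⟨v, e, hve, hsum⟩ := exists_coboundary_of_label h F (fun _ => 1) (fun _ => rfl)
          (fun x _ => by rw [eq_sub_iff_add_eq, ← hF, smul_inv_smul]) (-a h)
        refine ⟨v, fun x => b h x - e x, ?_, a h / (p ^ 2 : ℕ), fun x => ?_⟩
        · rw [mem_divSum, Finset.sum_sub_distrib, hb]
          simp only [Finset.sum_const, Finset.card_univ, hX] at hsum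
          have h2 : ∑ x, e x = a h * d' := by
            have hp2 : (p ^ 2 : ℤ) ≠ 0 := pow_ne_zero _ (by exact_mod_cast hp0)
            refine mul_left_cancel₀ hp2 ?_
            push_cast at hsum
            rw [hsum]
            simp only [nsmul_eq_mul]
            push_cast
            ring
          rw [h2, sub_self]
          exact dvd_zero _
        · have := hve x
          push_cast at this ⊢
          linear_combination -this)
  choose e he r hr using hv
  have hr' : ∀ h x, v (h⁻¹ • x) - v x = (b h x - e h x : ℤ) + -r h := by
    intro h x
    have := hr h x
    push_cast
    linear_combination -this
  have hhom := const_add_mem_int v (fun h x => b h x - e h x) (fun h => -r h) hr'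
  have hfix : ∀ w : H, (∃ x : X, w • x = x) → ∃ z : ℤ, -r w = z := by
    rintro w ⟨x, hx⟩
    have h1 := hr' w x
    have h2 : w⁻¹ • x = x := inv_smul_eq_iff.2 hx.symm
    rw [h2, sub_self] at h1
    exact ⟨-(b w x - e w x), by push_cast at h1 ⊢; linarith⟩
  have hpow : ∀ k : ℕ, ∃ z : ℤ, -r (u ^ k) = k * -r u + z := by
    intro k
    induction k with
    | zero =>
      obtain ⟨z, hz⟩ := hfix (u ^ 0) ⟨x₀, by rw [pow_zero, one_smul]⟩
      exact ⟨z, by rw [hz]; simp⟩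
    | succ k ih =>
      obtain ⟨z, hz⟩ := ih
      obtain ⟨z', hz'⟩ := hhom (u ^ k) u
      refine ⟨z + z', ?_⟩
      rw [pow_succ]
      push_cast
      linear_combination hz' + hz
  obtain ⟨z₀, hz₀⟩ := hpow p
  obtain ⟨z₁, hz₁⟩ := hfix w₁ hw₁
  obtain ⟨z₂, hz₂⟩ := hfix w₂ hw₂
  obtain ⟨z₃, hz₃⟩ := hhom (u ^ p) w₁
  rw [huw] at hz₃
  have hru : (p : ℚ) * r u = (z₀ + z₁ + z₃ - z₂ : ℤ) := by
    push_cast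
    linear_combination hz₃ + hz₀ + hz₁ - hz₂
  -- Summed over `X`, the constant `r u` contributes `d * (p * r u)`, a multiple of `d`; what is
  -- left is `p * d' ∣ a u * d'`.
  have h3 : ∑ x, (v (u⁻¹ • x) - v x) = 0 := by
    rw [Finset.sum_sub_distrib, sum_comp_smul, sub_self]
  simp only [hr', Finset.sum_add_distrib, Finset.sum_const, Finset.card_univ, hX] at h3
  rw [← Int.cast_sum, Finset.sum_sub_distrib, hb, nsmul_eq_mul] at h3
  have h4 : (a u * d' - ∑ x, e u x : ℤ) = (p * d' : ℕ) * (z₀ + z₁ + z₃ - z₂) := by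
    have : ((a u * d' - ∑ x, e u x : ℤ) : ℚ) = ((p * d' : ℕ) * (z₀ + z₁ + z₃ - z₂) : ℤ) := by
      push_cast at h3 hru ⊢
      linear_combination h3 + (p * d' : ℚ) * hru
    exact_mod_cast this
  have h5 : ((p * d' : ℕ) : ℤ) ∣ a u * d' := by
    have := dvd_add (Dvd.intro _ h4.symm) (mem_divSum.1 (he u))
    rwa [sub_add_cancel] at this
  rw [Nat.cast_mul] at h5
  exact hu (Int.dvd_of_mul_dvd_mul_right (by exact_mod_cast hd'0) h5)

/-- Blocks `ℤ/q` indexed by `ι`, on which an abelian group acts by translations via a family of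
homomorphisms to `ℤ/q`. -/
def Blocks {ι Γ : Type*} [AddCommGroup Γ] {q : ℕ} (_lam : ι → Γ →+ ZMod q) : Type _ := ι × ZMod q

section Blocks

variable {ι Γ : Type*} [AddCommGroup Γ] {q : ℕ} (lam : ι → Γ →+ ZMod q)

instance [Fintype ι] [NeZero q] : Fintype (Blocks lam) := inferInstanceAs (Fintype (ι × ZMod q))

instance : MulAction (Multiplicative Γ) (Blocks lam) where
  smul g x := (x.1, x.2 + lam x.1 g.toAdd)
  one_smul x := Prod.ext rfl (by change x.2 + lam x.1 0 = x.2; rw [map_zero, add_zero])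
  mul_smul g h x := Prod.ext rfl (by
    change x.2 + lam x.1 (g.toAdd + h.toAdd) = x.2 + lam x.1 h.toAdd + lam x.1 g.toAdd
    rw [map_add]; abel)

theorem Blocks.smul_fst (g : Multiplicative Γ) (x : Blocks lam) : (g • x).1 = x.1 := rfl

theorem Blocks.smul_snd (g : Multiplicative Γ) (x : Blocks lam) :
    (g • x).2 = x.2 + lam x.1 g.toAdd := rfl

theorem Blocks.smul_eq_self {g : Multiplicative Γ} {x : Blocks lam} (h : lam x.1 g.toAdd = 0) :
    g • x = x := Prod.ext rfl (by rw [Blocks.smul_snd, h, add_zero])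

theorem Blocks.card [Fintype ι] [NeZero q] :
    Fintype.card (Blocks lam) = Fintype.card ι * q := by
  change Fintype.card (ι × ZMod q) = _
  rw [Fintype.card_prod, ZMod.card]

theorem Blocks.sum_fst [Fintype ι] [NeZero q] (f : ι → ℤ) :
    ∑ x : Blocks lam, f x.1 = q * ∑ i, f i := by
  change ∑ x : ι × ZMod q, f x.1 = _
  simp [Fintype.sum_prod_type, ZMod.card, Finset.mul_sum]

end Blocks

/-- Three families of blocks: the two coordinates and their sum. -/
def threeHom (p α m : ℕ) (i : Fin m) : ZMod p × ZMod p →+ ZMod p :=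
  if i.1 < α then AddMonoidHom.fst _ _
  else if i.1 = α then AddMonoidHom.snd _ _
  else AddMonoidHom.fst _ _ + AddMonoidHom.snd _ _

/-- Write elements of the group as `(s, t)`. The cocycle is the constant `δ t / p` on the first `α`
blocks, where the action is by `s`. If `s ≠ 0`, these blocks have labels trivializing it; if `s = 0`
and `t ≠ 0`, the complementary blocks do, after subtracting a global constant. The two divisibility
conditions on `δ` keep the integral corrections inside `divSum`. Globally, `(1, 0)` and `(-1, 1)`
each fix a block outside the support, so neither allows a nonintegral constant, while their product
acts trivially on the support and has cocycle value `δ / p` there. -/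
theorem not_isQuasiPermutationLattice_of_three {p α m δ d : ℕ} [hp : Fact p.Prime] {L : Type*}
    [AddCommGroup L] {ρ : Representation ℤ (Multiplicative (ZMod p × ZMod p)) L} (hd : d ≠ 0)
    (hα : 1 ≤ α) (hm : α + 2 ≤ m) (hpδ : ¬ p ∣ δ) (h1 : d ∣ δ * α) (h2 : d ∣ δ * (m - α))
    (hL : IsSumLattice ρ (Blocks (threeHom p α m)) d) :
    ¬ IsQuasiPermutationLattice ρ := by
  intro hq
  have hp0 : p ≠ 0 := hp.1.ne_zero
  have hpQ : (p : ℚ) ≠ 0 := by exact_mod_cast hp0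
  have hpZ : (p : ℤ) ≠ 0 := by exact_mod_cast hp0
  let X := Blocks (threeHom p α m)
  let xA : X := (⟨0, by omega⟩, 0)
  let xB : X := (⟨α, by omega⟩, 0)
  let xC : X := (⟨α + 1, by omega⟩, 0)
  have : Nonempty X := ⟨xA⟩
  let ind : X → ℤ := fun x => if x.1.1 < α then 1 else 0
  have hcard : ((Finset.univ.filter fun i : Fin m => i.1 < α).card : ℤ) = α := by
    rw [Fin.card_filter_val_lt]; simp; omega
  have hindsum : ∑ x, ind x = p * α := by
    have h := Blocks.sum_fst (threeHom p α m) (fun i => if i.1 < α then (1 : ℤ) else 0)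
    refine h.trans ?_
    rw [Finset.sum_boole, hcard]
  have hindsum' : ∑ x, (1 - ind x) = p * (m - α) := by
    rw [Finset.sum_sub_distrib, hindsum]
    simp only [Finset.sum_const, Finset.card_univ, Blocks.card, X, Fintype.card_fin]
    simp only [nsmul_eq_mul]; push_cast; ring
  have h1' : (d : ℤ) ∣ δ * α := by exact_mod_cast h1
  have h2' : (d : ℤ) ∣ δ * (m - α) := by
    have := Int.natCast_dvd_natCast.2 h2
    rwa [Nat.cast_mul, Nat.cast_sub (by omega)] at this
  let t : Multiplicative (ZMod p × ZMod p) → ZMod p := fun g => g.toAdd.2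
  let c : Multiplicative (ZMod p × ZMod p) → X → ℚ := fun g x => ind x * (δ * (t g).val / p)
  have hlamA : ∀ (x : X) (g : Multiplicative (ZMod p × ZMod p)), x.1.1 < α → (g • x).2 = x.2 + g.toAdd.1 := by
    intro x g hx
    rw [Blocks.smul_snd]; simp [threeHom, hx]
  have hlamB : ∀ (x : X) (g : Multiplicative (ZMod p × ZMod p)), ¬ x.1.1 < α → g.toAdd.1 = 0 → (g • x).2 = x.2 + g.toAdd.2 := by
    intro x g hx hg
    rw [Blocks.smul_snd]
    simp only [threeHom, hx, if_false]
    split_ifs <;> simp [hg]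
  obtain ⟨v, hv⟩ := hL.coboundary hq hd c
    (by
      intro g h
      obtain ⟨e, he⟩ := ZMod.exists_val_eq_add (z := t g) (w := t (g * h)) (a := (t h).val)
        (by rw [Int.cast_natCast, ZMod.natCast_zmod_val]; rfl)
      refine ⟨fun x => δ * ind x * e, ?_, 0, fun x => ?_⟩
      · rw [mem_divSum, ← Finset.sum_mul, ← Finset.mul_sum, hindsum]
        exact (Dvd.dvd.mul_left h1' (p * e)).trans (dvd_of_eq (by ring))
      · have he' : ((t (g * h)).val : ℚ) = (t g).val + (t h).val + p * e := by exact_mod_cast he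
        have hi : ind (g⁻¹ • x) = ind x := rfl
        simp only [c, hi, he']
        push_cast
        field_simp
        ring)
    (by
      intro h
      by_cases hs : h.toAdd.1 = 0
      · by_cases ht : t h = 0
        · exact ⟨0, 0, zero_mem _, 0, fun x => by simp [c, ht]⟩
        · obtain ⟨v, e, hve, hsum⟩ := exists_coboundary_of_label h
            (fun x : X => (t h)⁻¹ * x.2) (fun x => 1 - ind x) (fun _ => rfl)
            (fun x hx => by
              have hx' : ¬ x.1.1 < α := fun h => hx (by simp [ind, h])
              rw [hlamB _ _ hx' (by simp [hs])]
              change (t h)⁻¹ * (x.2 + -(t h)) = _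
              rw [mul_add, mul_neg, inv_mul_cancel₀ ht]; ring) (-(δ * (t h).val))
          refine ⟨v, -e, ?_, δ * (t h).val / p, fun x => ?_⟩
          · rw [hindsum'] at hsum
            have : ∑ x, e x = δ * (m - α) * (t h).val :=
              mul_left_cancel₀ hpZ (by rw [hsum]; ring)
            refine neg_mem (mem_divSum.2 ?_)
            rw [this]
            exact h2'.mul_right _
          · have := hve x
            simp only [c, Pi.neg_apply]
            push_cast at this ⊢
            linear_combination -this
      · obtain ⟨v, e, hve, hsum⟩ := exists_coboundary_of_label h
          (fun x : X => (h.toAdd.1)⁻¹ * x.2) ind (fun _ => rfl)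
          (fun x hx => by
            have hx' : x.1.1 < α := by
              by_contra h
              exact hx (by simp [ind, h])
            rw [hlamA _ _ hx']
            change (h.toAdd.1)⁻¹ * (x.2 + -(h.toAdd.1)) = _
            rw [mul_add, mul_neg, inv_mul_cancel₀ hs]; ring) (δ * (t h).val)
        refine ⟨v, -e, ?_, 0, fun x => ?_⟩
        · rw [hindsum] at hsum
          have : ∑ x, e x = -(δ * α * (t h).val) :=
            mul_left_cancel₀ hpZ (by rw [hsum]; ring)
          refine neg_mem (mem_divSum.2 ?_)
          rw [this, dvd_neg]
          exact h1'.mul_right _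
        · have := hve x
          simp only [c, Pi.neg_apply]
          push_cast at this ⊢
          linear_combination -this)
  have hint : ∀ g (x₁ : X), ind x₁ = 0 → g⁻¹ • x₁ = x₁ →
      ∀ x, ∃ z : ℤ, v (g⁻¹ • x) - v x = c g x + z := by
    intro g x₁ hi hx₁ x
    obtain ⟨a, -, r, hr⟩ := hv g
    have e1 := hr x₁
    have e2 := hr x
    simp only [hx₁, c, hi] at e1
    refine ⟨a x₁ - a x, ?_⟩
    push_cast at e1 ⊢
    linear_combination e1 - e2
  -- Following `v` along `g₁` and then `g₂` from `xA` closes up, so the cocycle values `0` and `δ /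
  -- p` add up to an integer.
  let g₁ : Multiplicative (ZMod p × ZMod p) := Multiplicative.ofAdd (1, 0)
  let g₂ : Multiplicative (ZMod p × ZMod p) := Multiplicative.ofAdd (-1, 1)
  have hg : g₂⁻¹ • g₁⁻¹ • xA = xA := by
    rw [← mul_smul]
    refine Blocks.smul_eq_self _ ?_
    have : (0 : ℕ) < α := hα
    simp [xA, g₁, g₂, threeHom, this]
  obtain ⟨z₁, hz₁⟩ := hint g₁ xB (by simp [ind, xB]) (Blocks.smul_eq_self _ (by
    simp [xB, g₁, threeHom])) xA
  obtain ⟨z₂, hz₂⟩ := hint g₂ xC (by simp [ind, xC]) (Blocks.smul_eq_self _ (by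
    simp [xC, g₂, threeHom])) (g₁⁻¹ • xA)
  rw [hg] at hz₂
  have hc1 : c g₁ xA = 0 := by simp [c, g₁, t]
  have hc2 : c g₂ (g₁⁻¹ • xA) = δ / p := by
    have hi : ind (g₁⁻¹ • xA) = 1 := if_pos hα
    have : Fact (1 < p) := ⟨hp.1.one_lt⟩
    have ht : (t g₂).val = 1 := ZMod.val_one p
    simp only [c, ht, hi]
    push_cast
    ring
  rw [hc1] at hz₁
  rw [hc2] at hz₂
  have h3 : (δ : ℚ) = p * (-(z₁ + z₂) : ℤ) := by
    have h4 : (δ : ℚ) / p = (-(z₁ + z₂) : ℤ) := by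
      push_cast
      linear_combination -hz₁ - hz₂
    rw [← h4]; field_simp
  exact hpδ (Int.natCast_dvd_natCast.1 ⟨_, by exact_mod_cast h3⟩)

/-! ## The case `n = p d` with `p ∣ d` -/

/-- Two families of blocks of length `4`. -/
def twistHom (m : ℕ) (i : Fin m) : ZMod 4 × ZMod 4 →+ ZMod 4 :=
  if i.1 = 0 then AddMonoidHom.fst _ _ else AddMonoidHom.fst _ _ + 2 • AddMonoidHom.snd _ _

/-- The element `(0, 1)` fixes the first block and `(2, 1)` the others, and they differ by the
square of `(1, 0)`. When `s` is odd, both `s` and `s + 2t` are units of `ℤ/4` equal to their own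
inverses, and multiplication by them gives the labelling. -/
theorem not_isQuasiPermutationLattice_of_twist {m : ℕ} {L : Type*} [AddCommGroup L]
    {ρ : Representation ℤ (Multiplicative (ZMod 4 × ZMod 4)) L} (hm : 2 ≤ m)
    (hL : IsSumLattice ρ (Blocks (twistHom m)) (2 * m)) : ¬ IsQuasiPermutationLattice ρ := by
  have hsq : ∀ s t : ZMod 4, ¬ (2 : ℤ) ∣ (s.val : ℤ) → s * s = 1 ∧ (s + 2 * t) * (s + 2 * t) = 1 := by
    decide
  refine not_isQuasiPermutationLattice_of_hom Nat.prime_two (by omega) (dvd_mul_right _ _) ?_ hL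
    (fun g => (g.toAdd.1.val : ℤ)) (fun g h => ?_) (fun h hh => ?_) (Multiplicative.ofAdd (1, 0))
    (Multiplicative.ofAdd (0, 1)) (Multiplicative.ofAdd (2, 1)) (by decide) (by decide)
    ⟨(⟨0, by omega⟩, 0), Blocks.smul_eq_self _ ?_⟩ ⟨(⟨1, by omega⟩, 0), Blocks.smul_eq_self _ ?_⟩
  · rw [Blocks.card, Fintype.card_fin]; ring
  · obtain ⟨e, he⟩ := ZMod.exists_val_eq_add (z := g.toAdd.1) (w := (g * h).toAdd.1)
      (a := h.toAdd.1.val) (by rw [Int.cast_natCast, ZMod.natCast_zmod_val]; rfl)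
    refine ⟨2 * e, ?_⟩
    rw [he]
    push_cast
    ring
  · refine ⟨fun x => (twistHom m x.1 h.toAdd * x.2 : ZMod 4), fun x => ?_⟩
    change (twistHom m x.1 h.toAdd * (x.2 + twistHom m x.1 h.toAdd) : ZMod 4) =
      (twistHom m x.1 h.toAdd * x.2 + 1 : ZMod 4)
    have h1 : twistHom m x.1 h.toAdd * twistHom m x.1 h.toAdd = 1 := by
      have := hsq h.toAdd.1 h.toAdd.2 hh
      unfold twistHom
      split_ifs
      · exact this.1
      · simpa using this.2
    rw [mul_add, h1]
  · simp [twistHom]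
  · simp [twistHom]
    decide

/-- The permutations `z ↦ (1 + p b) z + c` of `ℤ/p²`. -/
def affinePerms (p : ℕ) : Subgroup (Equiv.Perm (ZMod (p ^ 2))) where
  carrier := {σ | ∃ b c, ∀ z, σ z = z + p * b * z + c}
  one_mem' := ⟨0, 0, by simp⟩
  mul_mem' := by
    rintro σ τ ⟨b, c, hσ⟩ ⟨b', c', hτ⟩
    have hp2 : (p : ZMod (p ^ 2)) ^ 2 = 0 := by rw [← Nat.cast_pow, ZMod.natCast_self]
    refine ⟨b + b', c' + p * b * c' + c, fun z => ?_⟩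
    rw [Equiv.Perm.mul_apply, hσ, hτ]
    linear_combination (b * b' * z) * hp2
  inv_mem' := by
    rintro σ ⟨b, c, hσ⟩
    have hp2 : (p : ZMod (p ^ 2)) ^ 2 = 0 := by rw [← Nat.cast_pow, ZMod.natCast_self]
    refine ⟨-b, p * b * c - c, fun z => ?_⟩
    rw [Equiv.Perm.inv_eq_iff_eq, hσ]
    linear_combination (b * b * z - b * b * c) * hp2

/-- Copies of `ℤ/p²` with the action of `affinePerms p`. -/
def AffineBlocks (p m : ℕ) : Type := Fin m × ZMod (p ^ 2)

instance (p m : ℕ) [NeZero p] : Fintype (AffineBlocks p m) :=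
  inferInstanceAs (Fintype (Fin m × ZMod (p ^ 2)))

instance (p m : ℕ) : MulAction (affinePerms p) (AffineBlocks p m) where
  smul σ x := (x.1, σ.1 x.2)
  one_smul _ := rfl
  mul_smul _ _ _ := rfl

/-- The homomorphism is the translation part `c` modulo `p`. With `u` the translation by `1` and
`w₁` the multiplication by `1 + p`, fixing `0`, the product `u ^ p * w₁` fixes `-1`. -/
theorem not_isQuasiPermutationLattice_of_affine {p m : ℕ} [hp : Fact p.Prime] {L : Type*}
    [AddCommGroup L] {ρ : Representation ℤ (affinePerms p) L} (hp2 : p ≠ 2) (hm : 0 < m)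
    (hL : IsSumLattice ρ (AffineBlocks p m) (p * m)) : ¬ IsQuasiPermutationLattice ρ := by
  have hsq : (p : ZMod (p ^ 2)) ^ 2 = 0 := by rw [← Nat.cast_pow, ZMod.natCast_self]
  have hp0 : p ≠ 0 := hp.1.ne_zero
  have h1p : Fact (1 < p ^ 2) := ⟨Nat.one_lt_pow two_ne_zero hp.1.one_lt⟩
  have hinv : ∀ c : ZMod (p ^ 2), ¬ (p : ℤ) ∣ c.val → ∃ ci, c * ci = 1 := by
    intro c hc
    have h1 : c.val.Coprime (p ^ 2) :=
      Nat.Coprime.pow_right 2 (Nat.coprime_comm.1 ((Nat.Prime.coprime_iff_not_dvd hp.1).2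
        (by exact_mod_cast hc)))
    have h2 := ZMod.coe_mul_inv_eq_one c.val h1
    rw [ZMod.natCast_zmod_val] at h2
    exact ⟨_, h2⟩
  obtain ⟨i2, hi2⟩ : ∃ i2 : ZMod (p ^ 2), 2 * i2 = 1 := by
    have h1 : Nat.Coprime 2 (p ^ 2) :=
      Nat.Coprime.pow_right 2 ((Nat.coprime_primes Nat.prime_two hp.1).2 hp2.symm)
    have h2 := ZMod.coe_mul_inv_eq_one 2 h1
    exact ⟨_, by exact_mod_cast h2⟩
  let w : Equiv.Perm (ZMod (p ^ 2)) :=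
    { toFun := fun z => z + p * z
      invFun := fun z => z - p * z
      left_inv := fun z => by linear_combination -z * hsq
      right_inv := fun z => by linear_combination -z * hsq }
  let u : affinePerms p := ⟨Equiv.addRight 1, 0, 1, fun z => by simp⟩
  let w₁ : affinePerms p := ⟨w, 1, 0, fun z => by simp [w]⟩
  refine not_isQuasiPermutationLattice_of_hom hp.1 (mul_ne_zero hp0 hm.ne') (dvd_mul_right _ _) ?_
    hL (fun σ => ((σ.1 0).val : ℤ)) ?_ ?_ u w₁ (u ^ p * w₁) ?_ rfl ⟨(⟨0, hm⟩, 0), ?_⟩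
    ⟨(⟨0, hm⟩, -1), ?_⟩
  · have : Fintype.card (AffineBlocks p m) = Fintype.card (Fin m) * Fintype.card (ZMod (p ^ 2)) :=
      Fintype.card_prod _ _
    rw [this, ZMod.card, Fintype.card_fin]; ring
  · rintro ⟨σ, b, c, hσ⟩ ⟨τ, b', c', hτ⟩
    obtain ⟨e, he⟩ := ZMod.exists_val_eq_add (z := τ 0) (w := (σ * τ) 0)
      (a := (σ 0).val + p * b.val * (τ 0).val) (by
        rw [Equiv.Perm.mul_apply, hσ (τ 0), hσ 0]
        push_cast
        simp only [ZMod.natCast_zmod_val]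
        ring)
    refine ⟨b.val * (τ 0).val + p * e, ?_⟩
    change (((σ * τ) 0).val : ℤ) - (σ 0).val - (τ 0).val = _
    rw [he]
    push_cast
    ring
  · rintro ⟨σ, b, c, hσ⟩ hc
    have hc0 : σ 0 = c := by rw [hσ]; ring
    simp only [hc0] at hc
    obtain ⟨ci, hci⟩ := hinv c hc
    -- For a unit `c`, a quadratic polynomial `F` solves `F (σ z) = F z + 1`: its `z²` term, a
    -- multiple of `p`, cancels the linear defect `p b z`, and `α` normalizes the constant. This
    -- needs `1/2`, hence `p` odd.
    let α := ci * (1 + p * b * i2)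
    refine ⟨fun x => α * x.2 + p * (-α * b * ci * i2) * x.2 ^ 2, fun x => ?_⟩
    change α * σ x.2 + p * (-α * b * ci * i2) * σ x.2 ^ 2 =
      α * x.2 + p * (-α * b * ci * i2) * x.2 ^ 2 + 1
    rw [hσ]
    obtain ⟨z, hz⟩ : ∃ z : ZMod (p ^ 2), z = x.2 := ⟨_, rfl⟩
    rw [← hz]
    linear_combination hsq * (-α * b * ci * i2 * (p * b ^ 2 * z ^ 2 + 2 * b * z ^ 2 + 2 * b * z * c)
      - c * ci * b ^ 2 * i2 ^ 2) + hci * (1 - 2 * p * α * b * i2 * z - p * α * b * c * i2)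
      - hi2 * (p * α * b * z)
  · have : ((Equiv.addRight (1 : ZMod (p ^ 2))) 0).val = 1 := by
      change ((0 : ZMod (p ^ 2)) + 1).val = 1
      rw [zero_add, ZMod.val_one]
    change ¬ (p : ℤ) ∣ (((Equiv.addRight (1 : ZMod (p ^ 2))) 0).val : ℤ)
    rw [this]
    exact_mod_cast hp.1.one_lt.ne' ∘ Nat.dvd_one.1
  · refine Prod.ext rfl ?_
    change w 0 = 0
    simp [w]
  · refine Prod.ext rfl ?_
    change ((Equiv.addRight (1 : ZMod (p ^ 2))) ^ p) (w (-1)) = -1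
    have hpow : ∀ (k : ℕ) (z : ZMod (p ^ 2)), ((Equiv.addRight (1 : ZMod (p ^ 2))) ^ k) z = z + k := by
      intro k
      induction k with
      | zero => simp
      | succ k ih =>
        intro z
        rw [pow_succ' (Equiv.addRight (1 : ZMod (p ^ 2))) k, Equiv.Perm.mul_apply, ih]
        simp [add_assoc]
    rw [hpow]
    simp [w]

/-! ## Invariants modulo norms -/

theorem LinearMap.finrank_range_add_finrank_ker_int {M N : Type*} [AddCommGroup M] [AddCommGroup N]
    [Module.Finite ℤ M] (f : M →ₗ[ℤ] N) :
    Module.finrank ℤ (LinearMap.range f) + Module.finrank ℤ (LinearMap.ker f) =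
      Module.finrank ℤ M := by
  rw [← Submodule.finrank_quotient_add_finrank (LinearMap.ker f), f.quotKerEquivRange.finrank_eq]

section Orbits

variable {H X : Type*} [Group H] [MulAction H X]

theorem exists_smul_out_eq (x : X) :
    ∃ h : H, h • (Quotient.mk (MulAction.orbitRel H X) x).out = x := by
  have h1 : (MulAction.orbitRel H X).r x (Quotient.mk (MulAction.orbitRel H X) x).out :=
    Setoid.symm' _ (Quotient.mk_out (s := MulAction.orbitRel H X) x)
  exact h1

theorem mk_smul_eq (h : H) (x : X) :
    Quotient.mk (MulAction.orbitRel H X) (h • x) = Quotient.mk (MulAction.orbitRel H X) x :=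
  Quotient.sound (s := MulAction.orbitRel H X) ⟨h, rfl⟩

theorem permRep_single [DecidableEq X] (h : H) (x : X) (a : ℤ) :
    permRep H X h (Pi.single x a) = Pi.single (h • x) a := by
  ext y
  simp only [permRep_apply, Pi.single_apply, inv_smul_eq_iff]

end Orbits

section Norm

variable {H L X Y : Type*} [Group H] [Fintype H] [AddCommGroup L] [MulAction H X] [MulAction H Y]

/-- The subgroup of norms in the group of invariants. -/
def normSubgroup (ρ : Representation ℤ H L) : AddSubgroup ρ.invariants where
  carrier := {v | ∃ l, ρ.norm l = v}
  zero_mem' := ⟨0, map_zero _⟩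
  add_mem' := by
    rintro _ _ ⟨l, hl⟩ ⟨l', hl'⟩
    exact ⟨l + l', by rw [map_add, hl, hl']; rfl⟩
  neg_mem' := by
    rintro _ ⟨l, hl⟩
    exact ⟨-l, by rw [map_neg, hl]; rfl⟩

theorem norm_mem_invariants (ρ : Representation ℤ H L) (l : L) : ρ.norm l ∈ ρ.invariants :=
  fun h => LinearMap.congr_fun (ρ.self_comp_norm h) l

theorem norm_apply (ρ : Representation ℤ H L) (l : L) : ρ.norm l = ∑ h, ρ h l := by
  simp [Representation.norm]

/-- A function on an `H`-set with norm zero is a combination of functions `h e - e`. -/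
theorem exists_eq_sum_of_norm_eq_zero [Fintype X] [DecidableEq X] (q : X → ℤ)
    (hq : (permRep H X).norm q = 0) :
    ∃ (t : X → H) (e : X → X → ℤ), q = ∑ x, (permRep H X (t x) (e x) - e x) := by
  choose t ht using exists_smul_out_eq (H := H) (X := X)
  let x₀ : X → X := fun x => (Quotient.mk (MulAction.orbitRel H X) x).out
  have hx₀ : ∀ (h : H) (x : X), x₀ (h • x) = x₀ x := fun h x => by simp only [x₀, mk_smul_eq]
  refine ⟨t, fun x => Pi.single (x₀ x) (q x), ?_⟩
  have h1 : ∀ x, permRep H X (t x) (Pi.single (x₀ x) (q x)) = Pi.single x (q x) := fun x => by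
    rw [permRep_single, ht]
  simp only [h1, Finset.sum_sub_distrib]
  rw [Finset.univ_sum_single]
  -- Moving all mass to the orbit representatives leaves the orbit sums of `q`, which vanish: `|H|`
  -- times this function is a combination of values of the norm.
  have h2 : ∑ x, (Pi.single (x₀ x) (q x) : X → ℤ) = 0 := by
    ext z
    have h3 : ∀ h : H, ∑ x, (Pi.single (x₀ x) (q (h⁻¹ • x)) : X → ℤ) z =
        ∑ x, (Pi.single (x₀ x) (q x) : X → ℤ) z := by
      intro h
      rw [← sum_comp_smul h⁻¹ (fun x => (Pi.single (x₀ x) (q x) : X → ℤ) z)]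
      simp only [hx₀]
    have h4 : ∑ h : H, ∑ x, (Pi.single (x₀ x) (q (h⁻¹ • x)) : X → ℤ) z = 0 := by
      rw [Finset.sum_comm]
      refine Finset.sum_eq_zero fun x _ => ?_
      have h5 : ∑ h : H, q (h⁻¹ • x) = 0 := by
        have := congrFun hq x
        rw [norm_apply, Finset.sum_apply] at this
        exact this
      simp only [Pi.single_apply]
      split_ifs
      · exact h5
      · simp
    simp only [h3, Finset.sum_const, Finset.card_univ, smul_eq_zero] at h4
    rw [Finset.sum_apply]
    exact h4.resolve_left Fintype.card_ne_zero
  rw [h2, sub_zero]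

variable [Fintype X] [Fintype Y] {ρ : Representation ℤ H L}

/-- If the invariants of `ℤ^X` map onto those of `ℤ^Y`, then ranks of invariants are additive and
indices of norms are multiplicative. -/
theorem PermResolution.finrank_index (R : PermResolution ρ X Y)
    (hR : ∀ q ∈ (permRep H Y).invariants, ∃ p ∈ (permRep H X).invariants, R.g p = q) :
    Module.finrank ℤ (permRep H X).invariants =
        Module.finrank ℤ (permRep H Y).invariants + Module.finrank ℤ ρ.invariants ∧
      (normSubgroup (permRep H X)).index =
        (normSubgroup (permRep H Y)).index * (normSubgroup ρ).index := by
  classical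
  let fI : ρ.invariants →ₗ[ℤ] (permRep H X).invariants :=
    (R.f.comp ρ.invariants.subtype).codRestrict _ fun l h => by
      change permRep H X h (R.f l) = R.f l
      rw [← R.f_rho, l.2 h]
  let gI : (permRep H X).invariants →ₗ[ℤ] (permRep H Y).invariants :=
    (R.g.comp (permRep H X).invariants.subtype).codRestrict _ fun p h => by
      change permRep H Y h (R.g p) = R.g p
      rw [← R.g_rho, p.2 h]
  have hf : Function.Injective fI := fun a b hab =>
    Subtype.ext (R.f_inj (congrArg Subtype.val hab))
  have hg : Function.Surjective gI := by
    rintro ⟨q, hq⟩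
    obtain ⟨p, hp, rfl⟩ := hR q hq
    exact ⟨⟨p, hp⟩, rfl⟩
  have hfg : LinearMap.ker gI = LinearMap.range fI := by
    ext p
    constructor
    · intro hp
      obtain ⟨l, hl⟩ := (R.exact p.1).1 (congrArg Subtype.val hp)
      refine ⟨⟨l, fun h => R.f_inj ?_⟩, Subtype.ext hl⟩
      rw [R.f_rho, hl, p.2 h]
    · rintro ⟨l, rfl⟩
      exact Subtype.ext (R.exact.apply_apply_eq_zero l.1)
  constructor
  · rw [← LinearMap.finrank_range_add_finrank_ker_int gI, hfg, LinearMap.finrank_range_of_inj hf,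
      LinearMap.range_eq_top.2 hg, finrank_top]
  · have hmap : (normSubgroup (permRep H X)).map gI.toAddMonoidHom = normSubgroup (permRep H Y) := by
      have hgN : ∀ p, R.g ((permRep H X).norm p) = (permRep H Y).norm (R.g p) := fun p => by
        simp only [norm_apply, map_sum, R.g_rho]
      ext q
      constructor
      · rintro ⟨p, ⟨p', hp'⟩, rfl⟩
        refine ⟨R.g p', ?_⟩
        rw [← hgN, hp']; rfl
      · rintro ⟨q', hq'⟩
        obtain ⟨p', rfl⟩ := R.g_surj q'
        refine ⟨⟨_, norm_mem_invariants _ p'⟩, ⟨p', rfl⟩, Subtype.ext ?_⟩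
        rw [← hq', ← hgN]; rfl
    -- This is injectivity on invariants modulo norms, from the vanishing of `Ĥ⁻¹(H, ℤ^Y)`: if `R.f
    -- l` is the norm of `p`, then `R.g p` has norm zero, and subtracting a lift made of terms `t e'
    -- - e'` moves `p` into the image of `R.f` without changing its norm.
    have hcomap : (normSubgroup (permRep H X)).comap fI.toAddMonoidHom = normSubgroup ρ := by
      have hfN : ∀ l, R.f (ρ.norm l) = (permRep H X).norm (R.f l) := fun p => by
        simp only [norm_apply, map_sum, R.f_rho]
      ext l
      constructor
      · rintro ⟨p, hp⟩
        replace hp : (permRep H X).norm p = R.f l := hp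
        obtain ⟨t, e, hte⟩ := exists_eq_sum_of_norm_eq_zero (H := H) (R.g p) (by
          have h1 : R.g ((permRep H X).norm p) = 0 := by rw [hp, R.exact.apply_apply_eq_zero]
          rw [← h1]
          simp only [norm_apply, map_sum, R.g_rho])
        choose e' he' using fun y => R.g_surj (e y)
        obtain ⟨l', hl'⟩ := (R.exact (p - ∑ y, (permRep H X (t y) (e' y) - e' y))).1 (by
          rw [map_sub, map_sum, sub_eq_zero, hte]
          simp only [map_sub, R.g_rho, he'])
        refine ⟨l', R.f_inj ?_⟩
        rw [hfN, hl', ← hp, map_sub, map_sum, sub_eq_self]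
        refine Finset.sum_eq_zero fun y _ => ?_
        rw [map_sub, sub_eq_zero]
        exact LinearMap.congr_fun ((permRep H X).norm_comp_self (t y)) (e' y)
      · rintro ⟨l', hl'⟩
        refine ⟨R.f l', ?_⟩
        rw [← hfN, hl']; rfl
    have hker : gI.toAddMonoidHom.ker = fI.toAddMonoidHom.range := by
      ext p
      exact SetLike.ext_iff.1 hfg p
    have h1 := (normSubgroup (permRep H X)).index_map gI.toAddMonoidHom
    rw [hmap, AddMonoidHom.range_eq_top.2 hg, AddSubgroup.index_top, mul_one, hker] at h1
    rw [h1, ← hcomap, AddSubgroup.index_comap, mul_comm,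
      ← AddSubgroup.relIndex_mul_index (le_sup_left (b := fI.toAddMonoidHom.range)), sup_comm,
      AddSubgroup.relIndex_sup_right]

end Norm

section PermCount

variable {H X : Type*} [Group H] [MulAction H X]

theorem permRep_invariants_eq {i : X → ℤ} (hi : i ∈ (permRep H X).invariants) (x : X) :
    i (Quotient.mk (MulAction.orbitRel H X) x).out = i x := by
  obtain ⟨h, hh⟩ := exists_smul_out_eq (H := H) x
  have h1 := congrFun (hi h) x
  rw [permRep_apply] at h1
  rw [← h1, inv_smul_eq_iff.2 hh.symm]

theorem finrank_permRep_invariants [Fintype X] :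
    Module.finrank ℤ (permRep H X).invariants = Nat.card (MulAction.orbitRel.Quotient H X) := by
  classical
  have := Fintype.ofFinite (MulAction.orbitRel.Quotient H X)
  let Φ : (MulAction.orbitRel.Quotient H X → ℤ) →ₗ[ℤ] (permRep H X).invariants :=
    (LinearMap.funLeft ℤ ℤ (Quotient.mk (MulAction.orbitRel H X))).codRestrict _ fun φ h => by
      ext x
      exact congrArg φ (mk_smul_eq h⁻¹ x)
  have hΦ : Function.Bijective Φ := by
    constructor
    · intro φ ψ h
      ext ω
      obtain ⟨x, rfl⟩ := Quotient.exists_rep ω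
      exact congrFun (congrArg Subtype.val h) x
    · intro i
      refine ⟨fun ω => i.1 ω.out, Subtype.ext (funext fun x => ?_)⟩
      exact permRep_invariants_eq i.2 x
  rw [← (LinearEquiv.ofBijective Φ hΦ).finrank_eq, Module.finrank_fintype_fun_eq_card,
    Nat.card_eq_fintype_card]

theorem card_inv_smul_eq [Fintype H] (h₀ : H) (x : X)
    [DecidablePred fun h : H => h⁻¹ • x = h₀⁻¹ • x] :
    (Finset.univ.filter fun h : H => h⁻¹ • x = h₀⁻¹ • x).card = Nat.card (MulAction.stabilizer H x) := by
  rw [← Fintype.card_subtype, ← Nat.card_eq_fintype_card]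
  refine Nat.card_congr ((Equiv.mulRight h₀⁻¹).subtypeEquiv fun h => ?_)
  rw [MulAction.mem_stabilizer_iff, Equiv.coe_mulRight, mul_smul, inv_smul_eq_iff, eq_comm]

/-- Invariants are determined by their values at orbit representatives, and there the norms take
exactly the multiples of the stabilizer order. -/
theorem index_normSubgroup_permRep [Fintype H] [Fintype X]
    [Fintype (MulAction.orbitRel.Quotient H X)] :
    (normSubgroup (permRep H X)).index =
      ∏ ω : MulAction.orbitRel.Quotient H X, Nat.card (MulAction.stabilizer H ω.out) := by
  classical
  let s : MulAction.orbitRel.Quotient H X → ℕ := fun ω => Nat.card (MulAction.stabilizer H ω.out)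
  let Ψ : (permRep H X).invariants →+ ∀ ω, ZMod (s ω) :=
    { toFun := fun i ω => (i.1 ω.out : ZMod (s ω))
      map_zero' := by ext; simp
      map_add' := fun i j => by ext; simp }
  have hnorm : ∀ (q : X → ℤ) x, (permRep H X).norm q x = ∑ h : H, q (h⁻¹ • x) := fun q x => by
    rw [norm_apply, Finset.sum_apply]; rfl
  have hker : Ψ.ker = normSubgroup (permRep H X) := by
    ext i
    constructor
    · intro hi
      have h1 : ∀ ω, (s ω : ℤ) ∣ i.1 ω.out := fun ω =>
        (ZMod.intCast_zmod_eq_zero_iff_dvd _ _).1 (congrFun hi ω)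
      choose a ha using h1
      let q : X → ℤ := fun x =>
        if x = (Quotient.mk (MulAction.orbitRel H X) x).out then a (Quotient.mk _ x) else 0
      refine ⟨q, funext fun x => ?_⟩
      rw [← permRep_invariants_eq i.2, ← permRep_invariants_eq (norm_mem_invariants _ q), hnorm]
      set ω : MulAction.orbitRel.Quotient H X := Quotient.mk (MulAction.orbitRel H X) x
      have h2 : ∀ h : H, q (h⁻¹ • ω.out) = if h⁻¹ • ω.out = (1 : H)⁻¹ • ω.out then a ω else 0 := by
        intro h
        have : Quotient.mk (MulAction.orbitRel H X) (h⁻¹ • ω.out) = ω := by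
          rw [mk_smul_eq]; exact Quotient.out_eq ω
        simp only [q, this, inv_one, one_smul]
      simp only [h2]
      rw [← Finset.sum_filter, Finset.sum_const, card_inv_smul_eq, ha ω, nsmul_eq_mul]
    · rintro ⟨q, hq⟩
      ext ω
      refine (ZMod.intCast_zmod_eq_zero_iff_dvd _ _).2 ?_
      rw [← hq, hnorm, ← Finset.sum_fiberwise_of_maps_to (t := Finset.univ)
        (g := fun h : H => h⁻¹ • ω.out) (fun _ _ => Finset.mem_univ _)]
      refine Finset.dvd_sum fun y _ => ?_
      rw [Finset.sum_congr rfl (g := fun _ => q y) (fun h hh => by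
        rw [(Finset.mem_filter.1 hh).2]), Finset.sum_const, nsmul_eq_mul]
      refine Dvd.dvd.mul_right (Int.natCast_dvd_natCast.2 ?_) _
      by_cases hy : ∃ h₀ : H, h₀⁻¹ • ω.out = y
      · obtain ⟨h₀, rfl⟩ := hy
        rw [card_inv_smul_eq]
      · rw [Finset.filter_false_of_mem fun h _ hh => hy ⟨h, hh⟩]
        exact dvd_zero _
  have hsurj : Function.Surjective Ψ := by
    intro z
    choose a ha using fun ω => ZMod.intCast_surjective (z ω)
    refine ⟨⟨fun x => a (Quotient.mk (MulAction.orbitRel H X) x), fun h => funext fun x => ?_⟩,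
      funext fun ω => ?_⟩
    · exact congrArg a (mk_smul_eq h⁻¹ x)
    · change ((a (Quotient.mk (MulAction.orbitRel H X) ω.out) : ℤ) : ZMod (s ω)) = z ω
      rw [show Quotient.mk (MulAction.orbitRel H X) ω.out = ω from Quotient.out_eq ω, ha]
  rw [← hker, AddSubgroup.index_ker, AddMonoidHom.range_eq_top.2 hsurj,
    Nat.card_congr AddSubgroup.topEquiv.toEquiv, Nat.card_pi]
  exact Finset.prod_congr rfl fun ω _ => Nat.card_zmod _

/-- For a group of order `p²`, the rank, the rank of invariants and the index of norms of a
permutation lattice are related modulo `(p - 1)²`. -/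
theorem permRep_card_relation [Fintype H] [Fintype X] {p : ℕ} (hp : p.Prime)
    (hH : Fintype.card H = p ^ 2) :
    ∃ e z : ℕ, (normSubgroup (permRep H X)).index = p ^ e ∧
      (Fintype.card X : ℤ) = Module.finrank ℤ (permRep H X).invariants +
        (p - 1) * (2 * Module.finrank ℤ (permRep H X).invariants - e) + (p - 1) ^ 2 * z := by
  classical
  have := Fintype.ofFinite (MulAction.orbitRel.Quotient H X)
  have h1 : ∀ ω : MulAction.orbitRel.Quotient H X, ∃ e z : ℕ,
      Nat.card (MulAction.stabilizer H ω.out) = p ^ e ∧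
      (Fintype.card (MulAction.orbit H ω.out) : ℤ) = 1 + (p - 1) * (2 - e) + (p - 1) ^ 2 * z := by
    intro ω
    have h2 := MulAction.card_orbit_mul_card_stabilizer_eq_card_group H ω.out
    rw [hH] at h2
    obtain ⟨e, he, hs⟩ := (Nat.dvd_prime_pow hp).1 (Dvd.intro_left _ h2)
    rw [hs] at h2
    have hp0 := hp.pos
    have h3 : Fintype.card (MulAction.orbit H ω.out) = p ^ (2 - e) := by
      refine Nat.eq_of_mul_eq_mul_right (pow_pos hp0 e) ?_
      rw [h2, ← pow_add, Nat.sub_add_cancel he]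
    rw [Nat.card_eq_fintype_card, hs, h3]
    -- The orbit length `p ^ (2 - e)` is expanded in powers of `p - 1`; the quadratic term occurs
    -- only for free orbits.
    interval_cases e
    · exact ⟨0, 1, rfl, by push_cast; ring⟩
    · exact ⟨1, 0, rfl, by push_cast; ring⟩
    · exact ⟨2, 0, rfl, by push_cast; ring⟩
  choose e z he hz using h1
  refine ⟨∑ ω, e ω, ∑ ω, z ω, ?_, ?_⟩
  · rw [index_normSubgroup_permRep, Finset.prod_congr rfl fun ω _ => he ω,
      Finset.prod_pow_eq_pow_sum]
  · rw [finrank_permRep_invariants, Nat.card_eq_fintype_card,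
      Fintype.card_congr (MulAction.selfEquivSigmaOrbits H X), Fintype.card_sigma]
    push_cast
    rw [Finset.sum_congr rfl fun ω _ => hz ω]
    simp only [Finset.sum_add_distrib, ← Finset.mul_sum, Finset.sum_sub_distrib, Finset.sum_const,
      Finset.card_univ, nsmul_eq_mul]
    ring

end PermCount

/-! ## The case `n = 2 p`, `d = 2` -/

theorem PermResolution.card_eq {H L X Y : Type*} [Group H] [AddCommGroup L] [MulAction H X]
    [MulAction H Y] [Fintype X] [Fintype Y] {ρ : Representation ℤ H L} (R : PermResolution ρ X Y) :
    Fintype.card X = Fintype.card Y + Module.finrank ℤ L := by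
  have h1 := LinearMap.finrank_range_add_finrank_ker_int R.g
  rw [LinearMap.range_eq_top.2 R.g_surj, finrank_top, LinearMap.exact_iff.1 R.exact,
    LinearMap.finrank_range_of_inj R.f_inj, Module.finrank_fintype_fun_eq_card,
    Module.finrank_fintype_fun_eq_card] at h1
  exact h1.symm

/-- `divSum X d` contains `d ℤ^X`, so it has full rank; constants belong to it because `d` divides
`|X|`. -/
theorem IsSumLattice.finrank_add_one {H L X : Type*} [Group H] [AddCommGroup L] [MulAction H X]
    [Fintype X] [Nonempty X] {ρ : Representation ℤ H L} {d : ℕ} (hL : IsSumLattice ρ X d)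
    (hd : d ≠ 0) (hdX : d ∣ Fintype.card X) : Module.finrank ℤ L + 1 = Fintype.card X := by
  obtain ⟨π, hs, hk, -⟩ := hL
  let x₀ : X := Classical.arbitrary X
  have hinj : Function.Injective (divSum X d).subtype.toIntLinearMap := Subtype.val_injective
  have hfin : Module.Finite ℤ (divSum X d) := Module.Finite.of_injective _ hinj
  have hrank : Module.finrank ℤ (divSum X d) = Fintype.card X := by
    refine le_antisymm ?_ ?_
    · have := LinearMap.finrank_le_finrank_of_injective hinj
      rwa [Module.finrank_fintype_fun_eq_card] at this
    · let m : (X → ℤ) →ₗ[ℤ] divSum X d := AddMonoidHom.toIntLinearMap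
        { toFun := fun a => ⟨(d : ℤ) • a, by
            rw [mem_divSum]; exact Finset.dvd_sum fun x _ => dvd_mul_right _ _⟩
          map_zero' := Subtype.ext (smul_zero _)
          map_add' := fun a b => Subtype.ext (smul_add _ _ _) }
      have hm : Function.Injective m := fun a b hab => by
        have h1 : (d : ℤ) • a = (d : ℤ) • b := congrArg Subtype.val hab
        exact smul_right_injective _ (by exact_mod_cast hd : (d : ℤ) ≠ 0) h1
      have := LinearMap.finrank_le_finrank_of_injective hm
      rwa [Module.finrank_fintype_fun_eq_card] at this
  have hker : Module.finrank ℤ (LinearMap.ker π.toIntLinearMap) = 1 := by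
    have hc : ∀ m : ℤ, (fun _ : X => m) ∈ divSum X d := fun m => by
      rw [mem_divSum, Finset.sum_const, Finset.card_univ, nsmul_eq_mul]
      exact (Int.natCast_dvd_natCast.2 hdX).mul_right m
    let κ : ℤ →ₗ[ℤ] LinearMap.ker π.toIntLinearMap := AddMonoidHom.toIntLinearMap
      { toFun := fun m => ⟨⟨_, hc m⟩, (hk _).2 ⟨m, fun _ => rfl⟩⟩
        map_zero' := rfl
        map_add' := fun _ _ => rfl }
    have hκ : Function.Bijective κ := by
      constructor
      · intro a b hab
        exact congrFun (congrArg Subtype.val (congrArg Subtype.val hab)) x₀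
      · rintro ⟨a, ha⟩
        obtain ⟨m, hm⟩ := (hk a).1 ha
        exact ⟨m, Subtype.ext (Subtype.ext (funext fun x => (hm x).symm))⟩
    rw [← (LinearEquiv.ofBijective κ hκ).finrank_eq, Module.finrank_self]
  have h1 := LinearMap.finrank_range_add_finrank_ker_int π.toIntLinearMap
  rw [LinearMap.range_eq_top.2 hs, finrank_top, hker, hrank] at h1
  exact h1

/-- Two blocks of length `p`, on each of which one factor of `ℤ/p × ℤ/p` acts. -/
def twoHom (p : ℕ) (i : Fin 2) : ZMod p × ZMod p →+ ZMod p :=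
  if i = 0 then AddMonoidHom.fst _ _ else AddMonoidHom.snd _ _

section Two

variable {p : ℕ} [hp : Fact p.Prime] {L : Type*} [AddCommGroup L]
  {ρ : Representation ℤ (Multiplicative (ZMod p × ZMod p)) L}

/-- The element of `ℤ/p × ℤ/p` moving the block `i` by `z`. -/
def blockMove (p : ℕ) (i : Fin 2) (z : ZMod p) : Multiplicative (ZMod p × ZMod p) :=
  if i = 0 then Multiplicative.ofAdd (z, 0) else Multiplicative.ofAdd (0, z)

theorem blockMove_smul (x : Blocks (twoHom p)) (z : ZMod p) :
    blockMove p x.1 z • x = ((x.1, x.2 + z) : Fin 2 × ZMod p) := by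
  refine Prod.ext rfl ?_
  rw [Blocks.smul_snd]
  unfold blockMove twoHom
  split_ifs <;> rfl

theorem blockMove_smul_of_ne {i : Fin 2} {x : Blocks (twoHom p)} (h : x.1 ≠ i) (z : ZMod p) :
    blockMove p i z • x = x := by
  refine Blocks.smul_eq_self _ ?_
  unfold blockMove twoHom
  split_ifs with h1 h2 h3
  · exact absurd (by omega) h
  · rfl
  · rfl
  · exact absurd (by omega) h

theorem eq_blockMove_mul (h : Multiplicative (ZMod p × ZMod p)) :
    h = blockMove p 0 h.toAdd.1 * blockMove p 1 h.toAdd.2 := by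
  refine Prod.ext ?_ ?_
  · change h.toAdd.1 = h.toAdd.1 + 0
    rw [add_zero]
  · change h.toAdd.2 = 0 + h.toAdd.2
    rw [zero_add]

/-- A function with `h w - w` integral up to constants is, up to functions constant on blocks,
integral. -/
theorem exists_int_coboundary (w : Blocks (twoHom p) → ℚ)
    (c : Multiplicative (ZMod p × ZMod p) → Blocks (twoHom p) → ℤ)
    (r : Multiplicative (ZMod p × ZMod p) → ℚ)
    (hw : ∀ h x, w (h⁻¹ • x) - w x = c h x + r h) :
    ∃ a : Blocks (twoHom p) → ℤ, ∀ h x, (a (h⁻¹ • x) - a x : ℚ) = c h x + r h := by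
  let x₀ : Fin 2 → Blocks (twoHom p) := fun i => ((i, 0) : Fin 2 × ZMod p)
  have : Nonempty (Blocks (twoHom p)) := ⟨x₀ 0⟩
  have hfix : ∀ h (x : Blocks (twoHom p)), h⁻¹ • x = x → ∃ z : ℤ, r h = z := by
    intro h x hx
    have := hw h x
    rw [hx, sub_self] at this
    exact ⟨-c h x, by push_cast; linarith⟩
  -- Each `h` is a product of two elements, each fixing one of the blocks pointwise, and on such
  -- elements `r` is integral.
  have hr : ∀ h, ∃ z : ℤ, r h = z := by
    intro h
    obtain ⟨z₁, h₁⟩ := hfix (blockMove p 0 h.toAdd.1) (x₀ 1)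
      (inv_smul_eq_iff.2 (blockMove_smul_of_ne one_ne_zero _).symm)
    obtain ⟨z₂, h₂⟩ := hfix (blockMove p 1 h.toAdd.2) (x₀ 0)
      (inv_smul_eq_iff.2 (blockMove_smul_of_ne zero_ne_one _).symm)
    obtain ⟨z₃, h₃⟩ := const_add_mem_int w c r hw (blockMove p 0 h.toAdd.1)
      (blockMove p 1 h.toAdd.2)
    refine ⟨z₁ + z₂ + z₃, ?_⟩
    rw [← eq_blockMove_mul, h₁, h₂] at h₃
    rw [h₃]; push_cast; ring
  -- Subtracting the value at the base point of each block leaves coboundaries unchanged, since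
  -- blocks are preserved.
  have hint : ∀ x, ∃ z : ℤ, w x - w (x₀ x.1) = z := by
    intro x
    have h1 := hw (blockMove p x.1 x.2)⁻¹ (x₀ x.1)
    obtain ⟨z, hz⟩ := hr (blockMove p x.1 x.2)⁻¹
    have h2 : blockMove p x.1 x.2 • x₀ x.1 = x := by
      refine (blockMove_smul (x₀ x.1) x.2).trans (Prod.ext rfl ?_)
      exact zero_add x.2
    rw [inv_inv, h2, hz] at h1
    exact ⟨_, by rw [h1, ← Int.cast_add]⟩
  choose a ha using hint
  refine ⟨a, fun h x => ?_⟩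
  rw [← ha, ← ha, ← hw]
  simp only [Blocks.smul_fst]
  ring

/-- The first cohomology of the lattice vanishes. -/
theorem IsSumLattice.exists_coboundary_two (hp2 : p ≠ 2)
    (hL : IsSumLattice ρ (Blocks (twoHom p)) 2) (c : Multiplicative (ZMod p × ZMod p) → L)
    (hc : ∀ g h, c (g * h) = c g + ρ g (c h)) : ∃ l, ∀ h, ρ h l - l = c h := by
  obtain ⟨π, hs, hk, heq⟩ := hL
  have hp0 : (p : ℚ) ≠ 0 := by exact_mod_cast hp.1.ne_zero
  choose e he using fun h => hs (c h)
  -- Summation over the group shows that `|H| = p²` kills the class of `c`. Below, `2` kills it too,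
  -- since twice an integral function has even sum; as `p` is odd, the class is zero.
  let v : L := -∑ g, c g
  have hv : ∀ h, ρ h v - v = (p ^ 2 : ℤ) • c h := by
    intro h
    have h1 : ∑ g, c (h * g) = ∑ g, c g := Fintype.sum_equiv (Equiv.mulLeft h) _ _ fun _ => rfl
    simp only [hc, Finset.sum_add_distrib, Finset.sum_const, Finset.card_univ] at h1
    have h2 : Fintype.card (Multiplicative (ZMod p × ZMod p)) = p ^ 2 := by
      rw [Fintype.card_multiplicative, Fintype.card_prod, ZMod.card, sq]
    rw [h2] at h1
    simp only [v, map_neg, map_sum]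
    rw [← h1, ← natCast_zsmul]
    push_cast
    abel
  obtain ⟨b, hb⟩ := hs v
  have hr : ∀ h, ∃ z : ℤ, ∀ x, b.1 (h⁻¹ • x) - b.1 x = p ^ 2 * (e h).1 x + z := by
    intro h
    have h1 := hv h
    rw [← hb, ← he, ← heq, ← map_sub, ← map_zsmul, ← sub_eq_zero, ← map_sub] at h1
    obtain ⟨z, hz⟩ := (hk _).1 h1
    exact ⟨z, fun x => by rw [← hz x]; simp⟩
  choose z hz using hr
  obtain ⟨a, ha⟩ := exists_int_coboundary (fun x => b.1 x / p ^ 2) (fun h => (e h).1)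
    (fun h => z h / p ^ 2) (fun h x => by
      have : (b.1 (h⁻¹ • x) - b.1 x : ℚ) = p ^ 2 * (e h).1 x + z h := by exact_mod_cast hz h x
      field_simp
      linear_combination this)
  have ha2 : (2 : ℤ) • a ∈ divSum (Blocks (twoHom p)) 2 := by
    rw [mem_divSum]
    exact Finset.dvd_sum fun x _ => dvd_mul_right _ _
  have hl : ∀ h, ρ h (π ⟨_, ha2⟩) - π ⟨_, ha2⟩ = (2 : ℤ) • c h := by
    intro h
    rw [← he, ← heq, ← map_sub, ← map_zsmul, ← sub_eq_zero, ← map_sub]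
    have hr : ∀ x, (2 * (a (h⁻¹ • x) - a x - (e h).1 x) : ℤ) = (2 * (z h / p ^ 2) : ℚ) := by
      intro x
      have := ha h x
      push_cast
      linear_combination 2 * this
    let x₀ : Blocks (twoHom p) := ((0, 0) : Fin 2 × ZMod p)
    refine (hk _).2 ⟨2 * (a (h⁻¹ • x₀) - a x₀ - (e h).1 x₀), fun x => ?_⟩
    have h3 : (2 * (a (h⁻¹ • x) - a x - (e h).1 x) : ℤ) = 2 * (a (h⁻¹ • x₀) - a x₀ - (e h).1 x₀) := by
      exact_mod_cast (hr x).trans (hr x₀).symm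
    rw [← h3]
    simp
    ring
  obtain ⟨k, hk2⟩ : Odd (p ^ 2) := (hp.1.odd_of_ne_two hp2).pow
  refine ⟨v - (k : ℤ) • π ⟨_, ha2⟩, fun h => ?_⟩
  have hk3 : (p : ℤ) ^ 2 = 2 * k + 1 := by exact_mod_cast hk2
  have h4 := hv h
  have h5 := hl h
  rw [hk3] at h4
  rw [map_sub, map_smul]
  calc _ = (ρ h v - v) - (k : ℤ) • (ρ h (π ⟨_, ha2⟩) - π ⟨_, ha2⟩) := by module
    _ = c h := by rw [h4, h5]; module

/-- An invariant class is represented by a function constant on blocks, since moving one block fixes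
the other and so leaves no room for an added constant. As `p` is odd, the two values have equal
parity, so twice the indicator of a block generates. Norms replace a function by `p` times its block
sums, whose difference is even. -/
theorem IsSumLattice.invariants_two (hp2 : p ≠ 2) (hL : IsSumLattice ρ (Blocks (twoHom p)) 2) :
    Module.finrank ℤ ρ.invariants = 1 ∧ (normSubgroup ρ).index = p := by
  obtain ⟨π, hs, hk, heq⟩ := hL
  let x₀ : Fin 2 → Blocks (twoHom p) := fun i => ((i, 0) : Fin 2 × ZMod p)
  have hk' : ∀ (a b : divSum (Blocks (twoHom p)) 2),
      π a = π b ↔ ∃ m : ℤ, ∀ x, a.1 x - b.1 x = m := fun a b => by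
    rw [← sub_eq_zero, ← map_sub, hk]; rfl
  let w : ℤ →+ divSum (Blocks (twoHom p)) 2 :=
    { toFun := fun k => ⟨fun x => if x.1 = 0 then 2 * k else 0, by
        rw [mem_divSum]
        exact Finset.dvd_sum fun x _ => by split_ifs <;> simp⟩
      map_zero' := Subtype.ext (funext fun x => by simp)
      map_add' := fun a b => Subtype.ext (funext fun x => by
        change (if x.1 = 0 then 2 * (a + b) else 0) =
          (if x.1 = 0 then 2 * a else 0) + (if x.1 = 0 then 2 * b else 0)
        split_ifs <;> ring) }
  have hw : ∀ k x, (w k).1 x = if x.1 = 0 then 2 * k else 0 := fun _ _ => rfl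
  have hw0 : ∀ k, (w k).1 (x₀ 0) = 2 * k := fun k => (hw k (x₀ 0)).trans (if_pos rfl)
  have hw1 : ∀ k, (w k).1 (x₀ 1) = 0 := fun k => (hw k (x₀ 1)).trans (if_neg one_ne_zero)
  let κ : ℤ →ₗ[ℤ] ρ.invariants := (π.comp w).toIntLinearMap.codRestrict _ fun k h => by
    change ρ h (π (w k)) = π (w k)
    rw [← heq]
    rfl
  have hinj : Function.Injective κ := by
    intro a b hab
    obtain ⟨m, hm⟩ := (hk' _ _).1 (congrArg Subtype.val hab : π (w a) = π (w b))
    have h0 := hm (x₀ 0)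
    have h1 := hm (x₀ 1)
    rw [hw0, hw0] at h0
    rw [hw1, hw1] at h1
    omega
  have hodd := hp.1.odd_of_ne_two hp2
  have hsurj : Function.Surjective κ := by
    rintro ⟨l, hl⟩
    obtain ⟨a, rfl⟩ := hs l
    have hconst : ∀ x, a.1 x = a.1 (x₀ x.1) := by
      intro x
      have h1 := hl (blockMove p x.1 x.2)⁻¹
      rw [← heq, hk'] at h1
      obtain ⟨m, hm⟩ := h1
      replace hm : ∀ y, a.1 ((blockMove p x.1 x.2)⁻¹⁻¹ • y) - a.1 y = m := hm
      have hm0 : m = 0 := by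
        obtain ⟨j, hj⟩ : ∃ j : Fin 2, j ≠ x.1 := exists_ne x.1
        have h2 := hm (x₀ j)
        rw [inv_inv, blockMove_smul_of_ne (show (x₀ j).1 ≠ x.1 from hj),
          sub_self] at h2
        exact h2.symm
      have h3 : blockMove p x.1 x.2 • x₀ x.1 = x := by
        refine (blockMove_smul (x₀ x.1) x.2).trans (Prod.ext rfl ?_)
        exact zero_add x.2
      have h4 := hm (x₀ x.1)
      rw [inv_inv, h3, hm0] at h4
      linarith
    have hsum : ∑ x, a.1 x = p * (a.1 (x₀ 0) + a.1 (x₀ 1)) := by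
      rw [Finset.sum_congr rfl fun x _ => hconst x, Blocks.sum_fst _ (fun i => a.1 (x₀ i)),
        Fin.sum_univ_two]
    have h5 := mem_divSum.1 a.2
    rw [hsum] at h5
    have h6 : (2 : ℤ) ∣ a.1 (x₀ 0) + a.1 (x₀ 1) :=
      (Int.prime_two.dvd_or_dvd h5).resolve_left fun h => by
        have := Int.natCast_dvd_natCast.1 h
        exact (Nat.not_even_iff_odd.2 hodd) (even_iff_two_dvd.2 this)
    obtain ⟨k, hk6⟩ := h6
    refine ⟨k - a.1 (x₀ 1), Subtype.ext ((hk' _ _).2 ⟨-a.1 (x₀ 1), fun x => ?_⟩)⟩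
    rw [hconst x, hw]
    split_ifs with hx
    · rw [hx]; linarith
    · rw [show x.1 = 1 by omega]; ring
  have hnorm : ∀ a : divSum (Blocks (twoHom p)) 2, ∃ b : divSum (Blocks (twoHom p)) 2,
      ρ.norm (π a) = π b ∧ ∀ x, b.1 x = p * ∑ z : ZMod p, a.1 ((x.1, z) : Fin 2 × ZMod p) := by
    intro a
    refine ⟨∑ h : Multiplicative (ZMod p × ZMod p), ⟨_, permRep_mem_divSum h a.2⟩, ?_,
      fun x => ?_⟩
    · rw [norm_apply, map_sum]
      exact Finset.sum_congr rfl fun h _ => (heq h a).symm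
    · rw [AddSubgroup.val_finsetSum, Finset.sum_apply]
      obtain ⟨i, z⟩ : Fin 2 × ZMod p := x
      let A : ZMod p → ℤ := fun y => a.1 ((i, y) : Fin 2 × ZMod p)
      have h1 : ∑ y, A (z - y) = ∑ y, A y := Equiv.sum_comp (Equiv.subLeft z) A
      refine (Fintype.sum_equiv Multiplicative.toAdd _
        (fun h : ZMod p × ZMod p => A (z + twoHom p i (-h))) fun h => rfl).trans ?_
      change _ = p * ∑ y, A y
      rw [← h1, Fintype.sum_prod_type]
      unfold twoHom
      split_ifs
      · simp [← sub_eq_add_neg, Finset.mul_sum]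
      · simp [← sub_eq_add_neg]
  have hcomap : (normSubgroup ρ).comap κ.toAddMonoidHom = AddSubgroup.zmultiples (p : ℤ) := by
    ext k
    rw [Int.mem_zmultiples_iff]
    constructor
    · rintro ⟨l, hl⟩
      obtain ⟨a, rfl⟩ := hs l
      obtain ⟨b, hb, hbx⟩ := hnorm a
      rw [hb] at hl
      obtain ⟨m, hm⟩ := (hk' _ _).1 (hl : π b = π (w k))
      have h0 := hm (x₀ 0)
      have h1 := hm (x₀ 1)
      rw [hw0, hbx] at h0
      rw [hw1, hbx] at h1
      have h2 : (p : ℤ) ∣ 2 * k := ⟨∑ z : ZMod p, a.1 ((0, z) : Fin 2 × ZMod p) -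
        ∑ z : ZMod p, a.1 ((1, z) : Fin 2 × ZMod p), by
          rw [mul_sub]
          change p * ∑ z : ZMod p, a.1 ((0, z) : Fin 2 × ZMod p) - 2 * k = m at h0
          change p * ∑ z : ZMod p, a.1 ((1, z) : Fin 2 × ZMod p) - 0 = m at h1
          linarith⟩
      refine ((Nat.prime_iff_prime_int.1 hp.1).dvd_or_dvd h2).resolve_left fun h => hp2 ?_
      exact (Nat.prime_dvd_prime_iff_eq hp.1 Nat.prime_two).1 (by exact_mod_cast h)
    · rintro ⟨j, rfl⟩
      -- Point masses `j` and `-j` in the two blocks: the sum is zero, and the norm is `p * j` times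
      -- the generator modulo constants.
      let a : divSum (Blocks (twoHom p)) 2 :=
        ⟨fun x => if x.2 = 0 then (if x.1 = 0 then j else -j) else 0, by
          rw [mem_divSum]
          change _ ∣ ∑ x : Fin 2 × ZMod p, (if x.2 = 0 then (if x.1 = 0 then j else -j) else 0 : ℤ)
          simp [Fintype.sum_prod_type]⟩
      obtain ⟨b, hb, hbx⟩ := hnorm a
      refine ⟨π a, hb.trans ((hk' _ _).2 ⟨-(p * j), fun x => ?_⟩)⟩
      rw [hbx, hw]
      change p * ∑ z : ZMod p, (if z = 0 then (if x.1 = 0 then j else -j) else 0 : ℤ) - _ = _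
      rw [Finset.sum_ite_eq' Finset.univ (0 : ZMod p), if_pos (Finset.mem_univ _)]
      split_ifs <;> ring
  constructor
  · rw [← (LinearEquiv.ofBijective κ ⟨hinj, hsurj⟩).finrank_eq, Module.finrank_self]
  · rw [← AddSubgroup.index_comap_of_surjective _ (f := κ.toAddMonoidHom) hsurj, hcomap,
      Int.index_zmultiples, Int.natAbs_natCast]

/-- The vanishing of `H¹` makes the three numbers of `permRep_card_relation` subtract along a
resolution. For this lattice they are rank `2p - 1`, invariant rank `1` and exponent `1`, so the
relation would give `p - 1 = (p - 1)² (z - z')`, impossible for odd `p`. -/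
theorem not_isQuasiPermutationLattice_of_two (hp2 : p ≠ 2)
    (hL : IsSumLattice ρ (Blocks (twoHom p)) 2) : ¬ IsQuasiPermutationLattice ρ := by
  intro hq
  obtain ⟨r, s, _, _, ⟨R⟩⟩ := hq.exists_resolution
  have hp1 := hp.1.one_lt
  have hH : Fintype.card (Multiplicative (ZMod p × ZMod p)) = p ^ 2 := by
    rw [Fintype.card_multiplicative, Fintype.card_prod, ZMod.card, sq]
  have hX : Fintype.card (Blocks (twoHom p)) = 2 * p := by rw [Blocks.card, Fintype.card_fin]
  have : Nonempty (Blocks (twoHom p)) := Fintype.card_pos_iff.1 (by rw [hX]; omega)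
  obtain ⟨h1, h2⟩ := R.finrank_index (by
    intro q hq
    obtain ⟨p₀, rfl⟩ := R.g_surj q
    have h1 : ∀ h, ∃ l, R.f l = permRep _ _ h p₀ - p₀ := fun h =>
      (R.exact _).1 (by rw [map_sub, R.g_rho, hq h, sub_self])
    choose c hc using h1
    obtain ⟨l, hl⟩ := hL.exists_coboundary_two hp2 c (fun g h => R.f_inj (by
      rw [map_add, R.f_rho, hc, hc, hc, map_mul, map_sub, Module.End.mul_apply]
      abel))
    refine ⟨p₀ - R.f l, fun h => ?_, by rw [map_sub, R.exact.apply_apply_eq_zero, sub_zero]⟩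
    have h2 := congrArg R.f (hl h)
    rw [map_sub, R.f_rho, hc] at h2
    rw [map_sub, sub_eq_sub_iff_sub_eq_sub, ← h2])
  obtain ⟨h3, h4⟩ := hL.invariants_two hp2
  obtain ⟨e, z, he, hz⟩ := permRep_card_relation (X := Fin r) hp.1 hH
  obtain ⟨e', z', he', hz'⟩ := permRep_card_relation (X := Fin s) hp.1 hH
  have h5 := R.card_eq
  have h6 := hL.finrank_add_one two_ne_zero (by rw [hX]; exact dvd_mul_right _ _)
  rw [hX] at h6
  rw [he, he', h4, ← pow_succ] at h2
  have h7 := Nat.pow_right_injective hp1 h2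
  rw [h3] at h1
  rw [h5, h1, h7] at hz
  have h8 : (Module.finrank ℤ L : ℤ) = 2 * p - 1 := by
    have : ((Module.finrank ℤ L + 1 : ℕ) : ℤ) = (2 * p : ℕ) := by rw [h6]
    push_cast at this
    linarith
  push_cast at hz
  rw [hz', h8] at hz
  have hp1' : (p : ℤ) - 1 ≠ 0 := by
    have : (1 : ℤ) < p := by exact_mod_cast hp1
    omega
  have h9 : ((p : ℤ) - 1) * (z - z') = 1 := by
    refine mul_left_cancel₀ hp1' ?_
    linear_combination -hz
  have h10 : (p : ℤ) - 1 ∣ 1 := Dvd.intro _ h9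
  rcases Int.isUnit_iff.1 (isUnit_of_dvd_one h10) with h | h
  · exact hp2 (by omega)
  · omega

end Two

/-! ### Restriction to subgroups of the symmetric group, and the choice of subgroup -/

theorem IsSumLattice.exists_restrict {L : Type*} (H Y : Type*) [Group H] [AddCommGroup L] [MulAction H Y]
    [Fintype Y] {n d : ℕ} {ρ : Representation ℤ (Equiv.Perm (Fin n)) L}
    (hL : IsSumLattice ρ (Fin n) d) (hq : IsQuasiPermutationLattice ρ) (hY : Fintype.card Y = n) :
    ∃ ρ' : Representation ℤ H L, IsSumLattice ρ' Y d ∧ IsQuasiPermutationLattice ρ' := by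
  let e : Y ≃ Fin n := Fintype.equivFinOfCardEq hY
  let φ : H →* Equiv.Perm (Fin n) := e.permCongrHom.toMonoidHom.comp (MulAction.toPermHom H Y)
  refine ⟨ρ.comp φ, hL.congr φ e fun h y => ?_, hq.comp φ⟩
  change e (h • y) = e (h • e.symm (e y))
  rw [Equiv.symm_apply_apply]

theorem IsSumLattice.not_isQuasiPermutationLattice {L : Type*} [AddCommGroup L] {n d : ℕ}
    {ρ : Representation ℤ (Equiv.Perm (Fin n)) L} (hL : IsSumLattice ρ (Fin n) d) (hdn : d ∣ n)
    (h1d : 1 < d) (hd : d < n) (hne : (n, d) ≠ (4, 2)) : ¬ IsQuasiPermutationLattice ρ := by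
  intro hq
  obtain ⟨m, rfl⟩ := hdn
  have hm1 : m ≠ 1 := by rintro rfl; omega
  obtain ⟨p, hp, r, rfl⟩ := Nat.exists_prime_and_dvd hm1
  have : Fact p.Prime := ⟨hp⟩
  have hr0 : r ≠ 0 := by rintro rfl; simp at hd
  have three : ∀ α δ : ℕ, 1 ≤ α → α + 2 ≤ d * r → ¬ p ∣ δ → d ∣ δ * α → d ∣ δ * (d * r - α) →
      False := by
    intro α δ h1 h2 h3 h4 h5
    obtain ⟨ρ', hL', hq'⟩ := hL.exists_restrict (Multiplicative (ZMod p × ZMod p))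
      (Blocks (threeHom p α (d * r))) hq (by
      rw [Blocks.card, Fintype.card_fin]; ring)
    exact not_isQuasiPermutationLattice_of_three (by omega) h1 h2 h3 h4 h5 hL' hq'
  by_cases hr : r = 1
  · subst hr
    rw [mul_one] at three hd hne
    by_cases hpd : p ∣ d
    · obtain ⟨m, rfl⟩ := hpd
      have hm : 0 < m := Nat.pos_of_ne_zero (by rintro rfl; simp at h1d)
      by_cases hp2 : p = 2
      · subst hp2
        have hm2 : 2 ≤ m := by
          by_contra h
          have : m = 1 := by omega
          subst this
          exact hne rfl
        obtain ⟨ρ', hL', hq'⟩ := hL.exists_restrict (Multiplicative (ZMod 4 × ZMod 4))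
          (Blocks (twistHom m)) hq (by
          rw [Blocks.card, Fintype.card_fin]; ring)
        exact not_isQuasiPermutationLattice_of_twist hm2 hL' hq'
      · obtain ⟨ρ', hL', hq'⟩ := hL.exists_restrict (affinePerms p) (AffineBlocks p m) hq (by
          have : Fintype.card (AffineBlocks p m) = Fintype.card (Fin m) *
            Fintype.card (ZMod (p ^ 2)) := Fintype.card_prod _ _
          rw [this, ZMod.card, Fintype.card_fin]; ring)
        exact not_isQuasiPermutationLattice_of_affine hp2 hm hL' hq'
    · by_cases hd2 : d = 2
      · subst hd2
        obtain ⟨ρ', hL', hq'⟩ := hL.exists_restrict (Multiplicative (ZMod p × ZMod p))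
          (Blocks (twoHom p)) hq (by
          rw [Blocks.card, Fintype.card_fin, mul_one])
        exact not_isQuasiPermutationLattice_of_two (fun h => hpd (h ▸ dvd_rfl)) hL' hq'
      -- With `d ≥ 3` blocks, a single one can carry the cocycle; `δ = d` is allowed because `p ∤
      -- d`.
      · exact three 1 d le_rfl (by omega) hpd (dvd_mul_right _ _) (dvd_mul_right _ _)
  -- With `d r ≥ 2 d` blocks, `d` of them carry the cocycle, so no multiplier is needed.
  · refine three d 1 (by omega) ?_ (fun h => hp.one_lt.ne' (Nat.dvd_one.1 h)) (by simp) ?_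
    · have : d * 2 ≤ d * r := Nat.mul_le_mul_left d (by omega)
      omega
    · rw [one_mul]
      exact Nat.dvd_sub (dvd_mul_right _ _) dvd_rfl

/-! ## The lattice `Q_n(d)` -/

/-- The projection of an integral vector to the vectors of sum zero. -/
def sumProj (n d : ℕ) : divSum (Fin n) d →ₗ[ℤ] (Fin n → ℚ) := AddMonoidHom.toIntLinearMap
  { toFun := fun a x => a.1 x - (∑ i, a.1 i : ℤ) / n
    map_zero' := by ext; simp
    map_add' := fun a b => by
      ext x
      simp only [AddSubgroup.coe_add, Pi.add_apply, Finset.sum_add_distrib]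
      push_cast
      ring }

theorem sumProj_apply {n d : ℕ} (a : divSum (Fin n) d) (x : Fin n) :
    sumProj n d a x = a.1 x - (∑ i, a.1 i : ℤ) / n := rfl

theorem fundWeight_apply (n : ℕ) (i x : Fin n) :
    fundWeight n i x = (if x = i then 1 else 0) - 1 / (n : ℚ) := by
  simp [fundWeight, stdVec, Pi.single_apply]

/-- The key identity is `a - mean = ∑ a_i (ε_i - ε_0) + (∑ a_i) ϖ₁`, whose last term is a multiple
of `d ϖ₁`. -/
theorem range_sumProj (n d : ℕ) [NeZero n] : LinearMap.range (sumProj n d) = latticeQ n d := by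
  apply le_antisymm
  · rintro _ ⟨a, rfl⟩
    obtain ⟨k, hk⟩ := mem_divSum.1 a.2
    have h1 : sumProj n d a = (∑ i, a.1 i • (stdVec n i - stdVec n 0)) +
        k • ((d : ℚ) • fundWeight n 0) := by
      ext x
      have hk' : ((∑ i, a.1 i : ℤ) : ℚ) = d * k := by exact_mod_cast hk
      rw [sumProj_apply, Pi.add_apply, Finset.sum_apply]
      simp only [Pi.smul_apply, Pi.sub_apply, fundWeight_apply, smul_sub, Finset.sum_sub_distrib]
      simp only [stdVec, Pi.single_apply, zsmul_eq_mul, mul_ite, mul_one, mul_zero, smul_eq_mul,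
        Finset.sum_ite_eq, Finset.mem_univ, if_true]
      rw [hk']
      split_ifs with h
      · rw [← Int.cast_sum, hk']; ring
      · simp; ring
    rw [h1]
    refine add_mem (Submodule.mem_sup_left (Submodule.sum_mem _ fun i _ =>
      Submodule.smul_mem _ _ (stdVec_sub_mem_rootLattice n _ _)))
      (Submodule.mem_sup_right (Submodule.smul_mem _ _ (Submodule.mem_span_singleton_self _)))
  · refine sup_le (Submodule.span_le.2 ?_) (Submodule.span_le.2 (Set.singleton_subset_iff.2 ?_))
    · rintro _ ⟨⟨i, j⟩, rfl⟩
      refine ⟨⟨Pi.single i 1 - Pi.single j 1, ?_⟩, ?_⟩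
      · rw [mem_divSum]; simp
      · ext x
        rw [sumProj_apply]
        simp [stdVec, Pi.single_apply]
    · refine ⟨⟨Pi.single 0 (d : ℤ), ?_⟩, ?_⟩
      · rw [mem_divSum]; simp
      · ext x
        rw [sumProj_apply, Pi.smul_apply, fundWeight_apply]
        simp only [Pi.single_apply, smul_eq_mul, Finset.sum_ite_eq', Finset.mem_univ, if_true]
        split_ifs <;> push_cast <;> ring

theorem isSumLattice_latticeQRep (n d : ℕ) [NeZero n] :
    IsSumLattice (latticeQRep n d) (Fin n) d := by
  have hn : (n : ℚ) ≠ 0 := by exact_mod_cast NeZero.ne n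
  refine ⟨((sumProj n d).codRestrict (latticeQ n d) fun a => by
    rw [← range_sumProj]; exact ⟨a, rfl⟩).toAddMonoidHom, ?_, fun a => ⟨fun h => ?_, ?_⟩, ?_⟩
  · rintro ⟨v, hv⟩
    rw [← range_sumProj] at hv
    obtain ⟨a, rfl⟩ := hv
    exact ⟨a, rfl⟩
  · have h1 : ∀ x, (a.1 x : ℚ) = (∑ i, a.1 i : ℤ) / n := fun x => by
      have := congrFun (congrArg Subtype.val h) x
      exact sub_eq_zero.1 this
    refine ⟨a.1 0, fun x => ?_⟩
    exact_mod_cast (h1 x).trans (h1 0).symm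
  · rintro ⟨m, hm⟩
    refine Subtype.ext (funext fun x => ?_)
    change sumProj n d a x = 0
    rw [sumProj_apply]
    simp only [hm, Finset.sum_const, Finset.card_univ, Fintype.card_fin, nsmul_eq_mul]
    push_cast
    field_simp
    ring
  · intro h a
    refine Subtype.ext (funext fun x => ?_)
    change sumProj n d _ x = sumProj n d a (h⁻¹ x)
    rw [sumProj_apply, sumProj_apply]
    congr 3
    exact sum_comp_smul h⁻¹ a.1

/-! ## The character lattice of `SL_n / μ_d` -/

section CharLattice

variable {n d : ℕ} {k : Type*} [Field k]

theorem prod_zpow_eq_zpow_sum {ι G : Type*} [CommGroup G] (s : Finset ι) (c : G) (a : ι → ℤ) :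
    ∏ i ∈ s, c ^ a i = c ^ ∑ i ∈ s, a i := by
  classical
  induction s using Finset.induction_on with
  | empty => simp
  | insert i s hi ih => rw [Finset.prod_insert hi, Finset.sum_insert hi, ih, zpow_add]

theorem diagTorusSL_apply_of_ne (t : diagTorusSL n k) {i j : Fin n} (h : i ≠ j) : t.1.1 i j = 0 :=
  t.2 h

theorem diagTorusSL_eq_diagonal (t : diagTorusSL n k) :
    t.1.1 = Matrix.diagonal fun i => t.1.1 i i :=
  ((Matrix.isDiag_iff_diagonal_diag t.1.1).1 t.2).symm

/-- The diagonal entries of elements of the diagonal torus, as characters. -/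
def diagEntry (n : ℕ) (k : Type*) [Field k] (i : Fin n) : diagTorusSL n k →* kˣ :=
  MonoidHom.toHomUnits
    { toFun := fun t => t.1.1 i i
      map_one' := Matrix.one_apply_eq i
      map_mul' := fun s t => by
        change (s.1.1 * t.1.1) i i = _
        rw [diagTorusSL_eq_diagonal s, diagTorusSL_eq_diagonal t, Matrix.diagonal_mul_diagonal]
        simp }

theorem coe_diagEntry (i : Fin n) (t : diagTorusSL n k) : (diagEntry n k i t : k) = t.1.1 i i := rfl

theorem prod_diagEntry (t : diagTorusSL n k) : ∏ i, diagEntry n k i t = 1 := by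
  refine Units.ext ?_
  rw [Units.coe_prod, Units.val_one, ← t.1.2]
  conv_rhs => rw [diagTorusSL_eq_diagonal t]
  rw [Matrix.det_diagonal]
  rfl

/-- The element of the diagonal torus with given diagonal entries. -/
def diagTorusMk (u : Fin n → kˣ) (hu : ∏ i, u i = 1) : diagTorusSL n k :=
  ⟨⟨Matrix.diagonal fun i => (u i : k), by
    rw [Matrix.det_diagonal, ← Units.coe_prod, hu, Units.val_one]⟩, Matrix.isDiag_diagonal _⟩

theorem diagEntry_diagTorusMk (u : Fin n → kˣ) (hu : ∏ i, u i = 1) (i : Fin n) :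
    diagEntry n k i (diagTorusMk u hu) = u i := by
  refine Units.ext ?_
  rw [coe_diagEntry]
  exact Matrix.diagonal_apply_eq _ i

theorem diagTorusSL_ext {s t : diagTorusSL n k} (h : ∀ i, diagEntry n k i s = diagEntry n k i t) :
    s = t := by
  refine Subtype.ext (Subtype.ext ?_)
  rw [diagTorusSL_eq_diagonal s, diagTorusSL_eq_diagonal t]
  congr 1
  funext i
  rw [← coe_diagEntry, ← coe_diagEntry, h]

/-- The character `t ↦ ∏ t_i ^ a_i` of the diagonal torus of `SL_n`. -/
def monChar (k : Type*) [Field k] (a : Fin n → ℤ) : diagTorusSL n k →* kˣ :=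
  ∏ i, diagEntry n k i ^ a i

theorem monChar_apply (a : Fin n → ℤ) (t : diagTorusSL n k) :
    monChar k a t = ∏ i, diagEntry n k i t ^ a i := by
  rw [monChar, MonoidHom.finsetProd_apply]
  rfl

theorem monChar_add (a b : Fin n → ℤ) : monChar k (a + b) = monChar k a * monChar k b := by
  ext t
  rw [MonoidHom.mul_apply, monChar_apply, monChar_apply, monChar_apply, ← Finset.prod_mul_distrib]
  simp only [Pi.add_apply, zpow_add]

theorem monChar_const (m : ℤ) : monChar k (fun _ : Fin n => m) = 1 := by
  ext t
  rw [monChar_apply, Finset.prod_zpow, prod_diagEntry, one_zpow, MonoidHom.one_apply]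

/-- Test the monomial on the element with entries `2` at `i` and `1/2` at `0`: in characteristic
zero `2` has infinite order. -/
theorem eq_const_of_monChar_eq_one [CharZero k] [NeZero n] {a : Fin n → ℤ} (h : monChar k a = 1) (i : Fin n) :
    a i = a 0 := by
  classical
  by_cases hi : i = 0
  · rw [hi]
  let two : kˣ := Units.mk0 2 two_ne_zero
  let u : Fin n → kˣ := Pi.mulSingle i two * Pi.mulSingle 0 two⁻¹
  have hu : ∏ j, u j = 1 := by
    simp only [u, Pi.mul_apply, Finset.prod_mul_distrib, Finset.prod_pi_mulSingle', Finset.mem_univ,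
      if_true, mul_inv_cancel]
  have h1 := DFunLike.congr_fun h (diagTorusMk u hu)
  rw [monChar_apply, MonoidHom.one_apply] at h1
  have h2 : ∀ j, diagEntry n k j (diagTorusMk u hu) ^ a j =
      (Pi.mulSingle i (two ^ a i) : Fin n → kˣ) j * (Pi.mulSingle 0 (two⁻¹ ^ a 0) : Fin n → kˣ) j := by
    intro j
    rw [diagEntry_diagTorusMk]
    simp only [u, Pi.mul_apply, mul_zpow, Pi.mulSingle_apply]
    congr 1
    · split_ifs with hj
      · rw [hj]
      · exact one_zpow _
    · split_ifs with hj
      · rw [hj]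
      · exact one_zpow _
  simp only [h2, Finset.prod_mul_distrib, Finset.prod_pi_mulSingle', Finset.mem_univ, if_true] at h1
  rw [inv_zpow, ← zpow_neg, ← zpow_add] at h1
  have h3 : ((2 : ℚ) ^ (a i + -a 0) : ℚ) = 1 := by
    have h4 := congrArg Units.val h1
    rw [Units.val_zpow_eq_zpow_val, Units.val_one] at h4
    have h5 : (((2 : ℚ) ^ (a i + -a 0) : ℚ) : k) = ((1 : ℚ) : k) := by
      push_cast
      exact h4
    exact_mod_cast h5
  have h6 := (zpow_eq_one_iff_right₀ (by norm_num : (0 : ℚ) ≤ 2) (by norm_num)).1 h3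
  omega

/-- A regular homomorphism on the diagonal torus of `SL_n` is a monomial. -/
theorem exists_eq_monChar (χ : diagTorusSL n k →* kˣ) (hχ : IsRegularFun fun t => (χ t : k)) :
    ∃ a, χ = monChar k a := by
  obtain ⟨f, hf⟩ := hχ
  let toK : (diagTorusSL n k →* kˣ) → (diagTorusSL n k →* k) := fun ψ => (Units.coeHom k).comp ψ
  let S : Set (diagTorusSL n k →* k) := Set.range fun a => toK (monChar k a)
  have hmem : (toK χ : diagTorusSL n k → k) ∈
      Submodule.span k ((fun ψ : diagTorusSL n k →* k => (ψ : diagTorusSL n k → k)) '' S) := by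
    have h1 : (toK χ : diagTorusSL n k → k) = ∑ m ∈ f.support, f.coeff m •
        fun t : diagTorusSL n k => ∏ p, t.1.1 p.1 p.2 ^ m p := by
      funext t
      rw [Finset.sum_apply]
      exact (hf t).trans (MvPolynomial.eval_eq' _ _)
    rw [h1]
    refine Submodule.sum_mem _ fun m _ => Submodule.smul_mem _ _ ?_
    by_cases hm : ∀ p : Fin n × Fin n, p.1 ≠ p.2 → m p = 0
    · refine Submodule.subset_span ⟨_, ⟨fun i => (m (i, i) : ℤ), rfl⟩, funext fun t => ?_⟩
      change ((monChar k _ t : kˣ) : k) = _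
      rw [monChar_apply, Units.coe_prod, Fintype.prod_prod_type]
      refine Finset.prod_congr rfl fun i _ => ?_
      rw [Finset.prod_eq_single i]
      · rw [zpow_natCast, Units.val_pow_eq_pow_val, coe_diagEntry]
      · intro j _ hj
        rw [hm (i, j) hj.symm, pow_zero]
      · exact fun h => absurd (Finset.mem_univ i) h
    · push Not at hm
      obtain ⟨p, hp, hmp⟩ := hm
      have h2 : (fun t : diagTorusSL n k => ∏ p, t.1.1 p.1 p.2 ^ m p) = 0 := funext fun t =>
        Finset.prod_eq_zero (Finset.mem_univ p) (by
          rw [diagTorusSL_apply_of_ne t hp, zero_pow hmp])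
      rw [h2]
      exact zero_mem _
  -- A polynomial in the entries restricts to a combination of monomial characters; by Dedekind's
  -- independence of characters, `χ` is one of them.
  have hS : toK χ ∈ S := by
    by_contra h
    exact (linearIndependent_monoidHom (diagTorusSL n k) k).notMem_span_image h hmem
  obtain ⟨a, ha⟩ := hS
  refine ⟨a, MonoidHom.ext fun t => Units.ext ?_⟩
  exact (DFunLike.congr_fun ha t).symm

theorem isRegularFun_monChar (a : Fin n → ℤ) :
    IsRegularFun fun t : diagTorusSL n k => (monChar k a t : k) := by
  -- Since the diagonal entries have product `1`, adding `m` to all exponents changes nothing and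
  -- makes them nonnegative.
  let m : ℤ := ∑ i, |a i|
  have hm : ∀ i, 0 ≤ a i + m := fun i => by
    have h1 : |a i| ≤ m := Finset.single_le_sum (f := fun i => |a i|)
      (fun _ _ => abs_nonneg _) (Finset.mem_univ i)
    have := neg_abs_le (a i)
    linarith
  refine ⟨∏ i, MvPolynomial.X (i, i) ^ (a i + m).toNat, fun t => ?_⟩
  have h1 : monChar k a t = monChar k (a + fun _ => m) t := by
    rw [monChar_add, MonoidHom.mul_apply, monChar_const, MonoidHom.one_apply, mul_one]
  change ((monChar k a t : kˣ) : k) = _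
  rw [h1, monChar_apply, Units.coe_prod, map_prod]
  refine Finset.prod_congr rfl fun i _ => ?_
  rw [map_pow, MvPolynomial.eval_X, ← coe_diagEntry, ← Units.val_pow_eq_pow_val, ← zpow_natCast,
    Int.toNat_of_nonneg (hm i)]
  rfl

theorem diagTorusProj_surjective : Function.Surjective (diagTorusProj n d k) :=
  MonoidHom.subgroupMap_surjective _ _

theorem mem_ker_diagTorusProj {t : diagTorusSL n k} :
    t ∈ (diagTorusProj n d k).ker ↔ ∃ c : kˣ, c ^ d = 1 ∧ ∀ i, diagEntry n k i t = c := by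
  have h1 : t ∈ (diagTorusProj n d k).ker ↔ t.1 ∈ muSubgroup n d k := by
    rw [MonoidHom.mem_ker, ← QuotientGroup.eq_one_iff, ← Subtype.coe_inj]
    rfl
  rw [h1]
  refine exists_congr fun c => and_congr_right fun _ => ⟨fun h i => Units.ext ?_, fun h => ?_⟩
  · rw [coe_diagEntry, h, Matrix.scalar_apply, Matrix.diagonal_apply_eq]
  · rw [diagTorusSL_eq_diagonal, Matrix.scalar_apply]
    congr 1
    funext i
    rw [← coe_diagEntry, h]

theorem ker_le_ker_monChar {a : Fin n → ℤ} (ha : a ∈ divSum (Fin n) d) :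
    (diagTorusProj n d k).ker ≤ (monChar k a).ker := by
  intro t ht
  obtain ⟨c, hc, h⟩ := mem_ker_diagTorusProj.1 ht
  obtain ⟨m, hm⟩ := mem_divSum.1 ha
  rw [MonoidHom.mem_ker, monChar_apply]
  simp only [h]
  rw [prod_zpow_eq_zpow_sum, hm, zpow_mul, zpow_natCast, hc, one_zpow]

/-- The character of the torus of `SL_n / μ_d` induced by `monChar`. -/
noncomputable def torusChar (k : Type*) [Field k] (a : divSum (Fin n) d) : diagTorus n d k →* kˣ :=
  (diagTorusProj n d k).liftOfSurjective diagTorusProj_surjective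
    ⟨monChar k a.1, ker_le_ker_monChar a.2⟩

theorem torusChar_apply (a : divSum (Fin n) d) (t : diagTorusSL n k) :
    torusChar k a (diagTorusProj n d k t) = monChar k a.1 t :=
  MonoidHom.liftOfRightInverse_comp_apply _ _ _ _ _

theorem diagTorus_hom_ext {χ ψ : diagTorus n d k →* kˣ}
    (h : ∀ t, χ (diagTorusProj n d k t) = ψ (diagTorusProj n d k t)) : χ = ψ := by
  refine MonoidHom.ext fun s => ?_
  obtain ⟨t, rfl⟩ := diagTorusProj_surjective s
  exact h t

/-- The exponents are tested on the scalar matrix of a primitive `d`-th root of unity, which has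
determinant `1` because `d ∣ n` and dies in the quotient. -/
theorem exists_eq_torusChar [IsAlgClosed k] [CharZero k] (hd : d ≠ 0) (hdn : d ∣ n)
    {χ : diagTorus n d k →* kˣ} (hχ : χ ∈ charGroup n d k) :
    ∃ a : divSum (Fin n) d, χ = torusChar k a := by
  obtain ⟨a, ha⟩ := exists_eq_monChar (χ.comp (diagTorusProj n d k)) hχ
  have hdk : NeZero (d : k) := ⟨by exact_mod_cast hd⟩
  obtain ⟨ζ, hζ⟩ := HasEnoughRootsOfUnity.exists_primitiveRoot k d
  have hζ0 : ζ ≠ 0 := hζ.ne_zero hd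
  let c : kˣ := Units.mk0 ζ hζ0
  have hc : IsPrimitiveRoot c d := IsPrimitiveRoot.coe_units_iff.1 hζ
  have hcn : ∏ _i : Fin n, c = 1 := by
    rw [Finset.prod_const, Finset.card_univ, Fintype.card_fin]
    exact (hc.pow_eq_one_iff_dvd n).2 hdn
  have hker : diagTorusMk (fun _ => c) hcn ∈ (diagTorusProj n d k).ker :=
    mem_ker_diagTorusProj.2 ⟨c, hc.pow_eq_one, fun i => diagEntry_diagTorusMk _ _ i⟩
  have h1 : monChar k a (diagTorusMk (fun _ => c) hcn) = 1 := by
    rw [← ha, MonoidHom.comp_apply, MonoidHom.mem_ker.1 hker, map_one]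
  rw [monChar_apply] at h1
  simp only [diagEntry_diagTorusMk] at h1
  rw [prod_zpow_eq_zpow_sum] at h1
  refine ⟨⟨a, (hc.zpow_eq_one_iff_dvd _).1 h1⟩, diagTorus_hom_ext fun t => ?_⟩
  rw [torusChar_apply, ← ha]
  rfl

end CharLattice

/-! ### The symmetric group inside the Weyl group -/

section Weyl

variable {n d : ℕ} {k : Type*} [Field k]

/-- The permutation of the diagonal entries of an element of the diagonal torus. -/
def diagPerm (σ : Equiv.Perm (Fin n)) (t : diagTorusSL n k) : diagTorusSL n k :=
  diagTorusMk (fun i => diagEntry n k (σ⁻¹ i) t) (by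
    rw [Equiv.prod_comp σ⁻¹ (fun i => diagEntry n k i t), prod_diagEntry])

theorem diagEntry_diagPerm (σ : Equiv.Perm (Fin n)) (t : diagTorusSL n k) (i : Fin n) :
    diagEntry n k i (diagPerm σ t) = diagEntry n k (σ⁻¹ i) t :=
  diagEntry_diagTorusMk _ _ i

theorem diagPerm_diagPerm_inv (σ : Equiv.Perm (Fin n)) (t : diagTorusSL n k) :
    diagPerm σ (diagPerm σ⁻¹ t) = t := by
  refine diagTorusSL_ext fun i => ?_
  rw [diagEntry_diagPerm, diagEntry_diagPerm, inv_inv, ← Equiv.Perm.mul_apply,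
    mul_inv_cancel, Equiv.Perm.one_apply]

/-- Permutations of the diagonal entries are conjugations by elements of `SL_n`. -/
theorem exists_conj_eq_diagPerm [NeZero n] (σ : Equiv.Perm (Fin n)) :
    ∃ m : Matrix.SpecialLinearGroup (Fin n) k, ∀ t : diagTorusSL n k,
      m * t.1 * m⁻¹ = (diagPerm σ t).1 := by
  let s : k := ((Equiv.Perm.sign σ : ℤˣ) : ℤ)
  have hs : s * s = 1 := by
    simp only [s]
    rw [← Int.cast_mul, ← Units.val_mul, Int.units_mul_self, Units.val_one, Int.cast_one]
  -- One entry of the permutation matrix is multiplied by the sign to make the determinant `1`;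
  -- diagonal factors do not affect conjugation on the torus.
  let u : Fin n → k := Pi.mulSingle 0 s
  let M : Matrix (Fin n) (Fin n) k := (σ⁻¹).permMatrix k * Matrix.diagonal u
  have hM : M.det = 1 := by
    rw [Matrix.det_mul, Matrix.det_permutation, Matrix.det_diagonal, Finset.prod_pi_mulSingle',
      if_pos (Finset.mem_univ _), Equiv.Perm.sign_inv]
    exact hs
  have hMe : ∀ i j, M i j = if σ⁻¹ i = j then u j else 0 := by
    intro i j
    simp [M, Matrix.mul_diagonal, Equiv.Perm.permMatrix, PEquiv.toMatrix_apply, eq_comm]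
  let m : Matrix.SpecialLinearGroup (Fin n) k := ⟨M, hM⟩
  refine ⟨m, fun t => mul_inv_eq_iff_eq_mul.2 (Subtype.ext ?_)⟩
  change M * t.1.1 = (diagPerm σ t).1.1 * M
  rw [diagTorusSL_eq_diagonal t, diagTorusSL_eq_diagonal (diagPerm σ t)]
  ext i j
  rw [Matrix.mul_diagonal, Matrix.diagonal_mul, hMe, ← coe_diagEntry i (diagPerm σ t),
    diagEntry_diagPerm, coe_diagEntry]
  split_ifs with h
  · rw [h, mul_comm]
  · rw [zero_mul, mul_zero]

theorem exists_weyl_eq_diagPerm [NeZero n] (d : ℕ) (k : Type*) [Field k] (σ : Equiv.Perm (Fin n)) :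
    ∃ w : WeylGroup (diagTorus n d k), ∀ t,
      weylAct (diagTorus n d k) w (diagTorusProj n d k t) = diagTorusProj n d k (diagPerm σ t) := by
  obtain ⟨m, hm⟩ := exists_conj_eq_diagPerm (k := k) σ
  let g : SLModMu n d k := QuotientGroup.mk' (muSubgroup n d k) m
  have hg : ∀ t, g * (diagTorusProj n d k t).1 * g⁻¹ = (diagTorusProj n d k (diagPerm σ t)).1 := by
    intro t
    change QuotientGroup.mk' (muSubgroup n d k) (m * t.1 * m⁻¹) =
      QuotientGroup.mk' (muSubgroup n d k) (diagPerm σ t).1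
    rw [hm]
  have hgN : g ∈ Subgroup.normalizer (diagTorus n d k : Set (SLModMu n d k)) := by
    refine Subgroup.mem_normalizer_iff.2 fun h => ⟨fun hh => ?_, fun hh => ?_⟩
    · obtain ⟨t, ht⟩ := diagTorusProj_surjective ⟨h, hh⟩
      have h1 := hg t
      rw [ht] at h1
      rw [h1]
      exact Subtype.property _
    · obtain ⟨t, ht⟩ := diagTorusProj_surjective ⟨_, hh⟩
      have h1 := hg (diagPerm σ⁻¹ t)
      rw [diagPerm_diagPerm_inv, ht] at h1
      have h2 := mul_left_cancel (mul_right_cancel h1)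
      rw [← h2]
      exact Subtype.property _
  exact ⟨QuotientGroup.mk ⟨g, hgN⟩, fun t => Subtype.ext (hg t)⟩

/-- The chosen matrices need not multiply like permutations, but their classes do, because the Weyl
group acts faithfully on the torus. -/
theorem exists_perm_hom_weyl [NeZero n] (d : ℕ) (k : Type*) [Field k] :
    ∃ φ : Equiv.Perm (Fin n) →* WeylGroup (diagTorus n d k), ∀ σ t,
      weylAct (diagTorus n d k) (φ σ) (diagTorusProj n d k t) =
        diagTorusProj n d k (diagPerm σ t) := by
  choose w hw using exists_weyl_eq_diagPerm (n := n) d k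
  refine ⟨MonoidHom.mk' w fun σ τ => ?_, hw⟩
  refine QuotientGroup.kerLift_injective (diagTorus n d k).normalizerMonoidHom ?_
  change weylAct (diagTorus n d k) (w (σ * τ)) = weylAct (diagTorus n d k) (w σ * w τ)
  rw [map_mul]
  refine MulEquiv.ext fun s => ?_
  obtain ⟨t, rfl⟩ := diagTorusProj_surjective s
  rw [MulAut.mul_apply, hw, hw, hw]
  congr 1
  refine diagTorusSL_ext fun i => ?_
  rw [diagEntry_diagPerm, diagEntry_diagPerm, diagEntry_diagPerm, mul_inv_rev,
    Equiv.Perm.mul_apply]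

/-- The characters of the torus of `SL_n / μ_d` are the integral vectors with sum divisible by `d`,
modulo constants. -/
theorem exists_isSumLattice_charLatticeRep [NeZero n] (hd : d ≠ 0) (hdn : d ∣ n) (k : Type*)
    [Field k] [IsAlgClosed k] [CharZero k] :
    ∃ φ : Equiv.Perm (Fin n) →* WeylGroup (diagTorus n d k),
      IsSumLattice ((charLatticeRep n d k).comp φ :
        Representation ℤ (Equiv.Perm (Fin n)) (Additive (charGroup n d k))) (Fin n) d := by
  obtain ⟨φ, hφ⟩ := exists_perm_hom_weyl (n := n) d k
  have hreg : ∀ a : divSum (Fin n) d, torusChar k a ∈ charGroup n d k := fun a => by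
    change IsRegularFun _
    simp only [torusChar_apply]
    exact isRegularFun_monChar a.1
  refine ⟨φ, { toFun := fun a => Additive.ofMul ⟨torusChar k a, hreg a⟩
               map_zero' := ?_
               map_add' := fun a b => ?_ }, ?_, fun a => ⟨fun h => ?_, ?_⟩, fun σ a => ?_⟩
  · refine Subtype.ext (diagTorus_hom_ext fun t => ?_)
    refine (torusChar_apply _ t).trans ?_
    exact DFunLike.congr_fun (monChar_const 0) t
  · refine Subtype.ext (diagTorus_hom_ext fun t => ?_)
    change torusChar k (a + b) _ = torusChar k a _ * torusChar k b _
    rw [torusChar_apply, torusChar_apply, torusChar_apply, AddSubgroup.coe_add, monChar_add,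
      MonoidHom.mul_apply]
  · rintro χ
    obtain ⟨a, ha⟩ := exists_eq_torusChar hd hdn χ.toMul.2
    exact ⟨a, Subtype.ext ha.symm⟩
  · have h1 : torusChar k a = 1 := congrArg Subtype.val h
    refine ⟨a.1 0, eq_const_of_monChar_eq_one (k := k) (MonoidHom.ext fun t => ?_)⟩
    rw [← torusChar_apply, h1]
    rfl
  · rintro ⟨m, hm⟩
    refine Subtype.ext (diagTorus_hom_ext fun t => ?_)
    refine (torusChar_apply _ t).trans ?_
    have h1 : a.1 = fun _ => m := funext hm
    rw [h1, monChar_const]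
    rfl
  · refine Subtype.ext (diagTorus_hom_ext fun t => ?_)
    change torusChar k _ _ = torusChar k a (weylAct _ (φ σ)⁻¹ (diagTorusProj n d k t))
    rw [← map_inv, hφ, torusChar_apply, torusChar_apply, monChar_apply, monChar_apply]
    simp only [diagEntry_diagPerm, inv_inv, permRep_apply]
    refine (Equiv.prod_comp σ _).symm.trans (Finset.prod_congr rfl fun i _ => ?_)
    rw [← Equiv.Perm.smul_def, inv_smul_smul]

end Weyl

theorem proposition5p1 (n d : ℕ) [NeZero n] (hdn : d ∣ n) (h1d : 1 < d) (hd : d < n)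
    (hne : (n, d) ≠ (4, 2)) :
    -- the lattice `Q_n(d)` is not a quasi-permutation lattice for the symmetric group
    ¬ IsQuasiPermutationLattice (latticeQRep n d) ∧
    -- the character lattice of `SL_n / μ_d` is not a quasi-permutation lattice for the Weyl group
    ∀ (k : Type*) [Field k] [IsAlgClosed k] [CharZero k],
      ¬ IsQuasiPermutationLattice (charLatticeRep n d k) := by
  refine ⟨(isSumLattice_latticeQRep n d).not_isQuasiPermutationLattice hdn h1d hd hne, ?_⟩
  intro k _ _ _ hq
  obtain ⟨φ, hφ⟩ := exists_isSumLattice_charLatticeRep (by omega) hdn k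
  exact hφ.not_isQuasiPermutationLattice hdn h1d hd hne (hq.comp φ)
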